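/- **Setting.** Let $Y$ be a closed connected complex manifold of dimension $d-1$ ($d\ge 1$), $\sigma$ an automorphism of $Y$ of finite order $n$, and $\omega_Y$ a $\sigma$-invariant Kähler form on $Y$; let $\sigma$ act on $\mathbb{C}$ by multiplication by a primitive $n$-th root of unity. Let $\beta>0$. A non-compact, connected, complete Kähler $d$-fold $(X,\omega)$ is *weak $\beta$-ALG* (with these data) if there are compact sets $K\subset X$, $K'\subset(\mathbb{C}\times Y)/\langle\sigma\rangle$ and a diffeomorphism $\Phi:\frac{\mathbb{C}\times Y}{\langle\sigma\rangle}\setminus K'\to X\setminus K$ such that the composition of $\Phi^{-1}$ with the projection to $\mathbb{C}/\langle\sigma\rangle$ is holomorphic, and, for some $\lambda>0$ and $C>0$, $$\tfrac1C\left(\tfrac i2\lambda^2|z|^{2\beta-2}dz\wedge d\bar z+\omega_Y\right)\le\Phi^*\omega\le C\left(\tfrac i2\lambda^2|z|^{2\beta-2}dz\wedge d\bar z+\omega_Y\right)$$ (an inequality between the associated Riemannian metrics, on the cover $\mathbb{C}\times Y$). Let $(X,\omega)$ be weak $\beta$-ALG, let $R>0$ be so large that $K'\subset\{|z|\le R\}$,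 and put $u=1/z=\rho e^{i\theta}$ on $\{|z|>R\}$. Let $\Upsilon$ be a smooth real volume form on $X$ with $\Upsilon/\omega^d>0$ everywhere and $\Upsilon/\omega^d-1$ integrable with respect to $\omega^d$. Let $\chi:\mathbb{R}\to[0,1]$ be a smooth cutoff function with $\chi=1$ on $[2,3]$ and $\chi(y)=0$ if $y\le1$ or $y\ge4$. For real $t,s$ let $$\eta=s\,\chi(\rho t)\,\rho\,d\rho\wedge d\theta=s\,\chi(\rho t)\,\tfrac i2\,du\wedge d\bar u$$ on the part $\{|z|>R\}$ of the end of $X$, and $\eta=0$ on the rest of $X$. **Lemma.** There is a constant $Q\ge10$ such that on $\{|z|>R\}$ $$\tfrac1Q\left(\tfrac i2\,\tfrac{du\wedge d\bar u}{|u|^{2+2\beta}}+\omega_Y\right)\le\Phi^*\omega\le Q\left(\tfrac i2\,\tfrac{du\wedge d\bar u}{|u|^{2+2\beta}}+\omega_Y\right).$$ For every such $Q$ put $$t_0=\max\left\{10R,\ \left[\frac{1000\cdot32^{2+2\beta}\,Q^{d}\,n\,\left|\int_X(\omega^d-\Upsilon)\right|}{2\pi\,d!\,\mathrm{Vol}(Y)\int_0^\infty\chi(y)\,y\,dy}\right]^{\frac1{2\beta}}\right\}>0,\qquad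 \mathrm{Vol}(Y)=\int_Y\frac{\omega_Y^{d-1}}{(d-1)!}.$$ Then for every $t>t_0$ there is $s\in\mathbb{R}$ such that $\omega_0=\omega+\eta$ is a Kähler form on $X$ (smooth, closed and positive definite), the top form $\omega_0^d-\Upsilon$ is integrable over $X$, and $$\int_X(\omega_0^d-\Upsilon)=0.$$ -/

import Mathlib

open Set Filter Topology MeasureTheory
open scoped Manifold

noncomputable section

/-- The model space `ℂ^d` of complex `d`-folds. -/
abbrev Cn (d : ℕ) : Type := Fin d → ℂ

/-- Real 2-forms on a complex `d`-fold.  The tangent space of `X` at `x` is, as in Mathlib, the model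
space `ℂ^d`, identified through the preferred chart at `x`; as the charts are holomorphic, its complex
structure `J` is multiplication by `i`. -/
abbrev TwoForm (d : ℕ) (X : Type*) : Type _ := X → Cn d [⋀^Fin 2]→L[ℝ] ℝ

/-- Real forms of top degree `2d` on a complex `d`-fold.  The `2d` arguments are indexed by pairs
`(j, k)` with `j < d` and `k < 2`. -/
abbrev TopForm (d : ℕ) (X : Type*) : Type _ := X → Cn d [⋀^Fin d × Fin 2]→ₗ[ℝ] ℝ

/-- The positively oriented real frame `e₁, i e₁, …, e_d, i e_d` of `ℂ^d`. -/
def stdFrame (d : ℕ) (p : Fin d × Fin 2) : Cn d :=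
  if p.2 = 0 then Pi.single p.1 1 else Pi.single p.1 Complex.I

/-- The real area form `(i/2) du ∧ dū = dx ∧ dy` on `ℂ`. -/
def areaForm : ℂ [⋀^Fin 2]→L[ℝ] ℝ :=
  ContinuousMultilinearMap.alternatization
    ((ContinuousMultilinearMap.mkPiAlgebra ℝ (Fin 2) ℝ).compContinuousLinearMap
      ![Complex.reCLM, Complex.imCLM])

section PointwisePower

/-- `v ↦ ∏ j, a (v (j,0), v (j,1))`, the tensor product of `d` copies of a 2-form `a`. -/
def twoFormTensorPow {d : ℕ} (a : Cn d [⋀^Fin 2]→L[ℝ] ℝ) :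
    MultilinearMap ℝ (fun _ : Fin d × Fin 2 => Cn d) ℝ where
  toFun v := ∏ j : Fin d, a (fun k => v (j, k))
  map_update_add' := by
    intro inst v p x y
    have e : inst = instDecidableEqProd := Subsingleton.elim _ _
    subst e
    obtain ⟨j, k⟩ := p
    have h1 : ∀ z : Cn d, (fun k' => Function.update v (j, k) z (j, k'))
        = Function.update (fun k' => v (j, k')) k z := by
      intro z; funext k'; simp only [Function.update_apply, Prod.mk.injEq, true_and]
    have h2 : ∀ (z : Cn d) (i : Fin d), i ≠ j →
        (fun k' => Function.update v (j, k) z (i, k')) = fun k' => v (i, k') := by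
      intro z i hi; funext k'; simp [hi]
    have h3 : ∀ z : Cn d, ∏ i : Fin d, a (fun k' => Function.update v (j, k) z (i, k'))
        = a (Function.update (fun k' => v (j, k')) k z)
          * ∏ i ∈ Finset.univ.erase j, a (fun k' => v (i, k')) := by
      intro z
      rw [← Finset.mul_prod_erase _ _ (Finset.mem_univ j), h1]
      congr 1
      exact Finset.prod_congr rfl fun i hi => by rw [h2 z i (Finset.ne_of_mem_erase hi)]
    rw [h3, h3, h3, a.map_update_add, add_mul]
  map_update_smul' := by
    intro inst v p c x
    have e : inst = instDecidableEqProd := Subsingleton.elim _ _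
    subst e
    obtain ⟨j, k⟩ := p
    have h1 : ∀ z : Cn d, (fun k' => Function.update v (j, k) z (j, k'))
        = Function.update (fun k' => v (j, k')) k z := by
      intro z; funext k'; simp only [Function.update_apply, Prod.mk.injEq, true_and]
    have h2 : ∀ (z : Cn d) (i : Fin d), i ≠ j →
        (fun k' => Function.update v (j, k) z (i, k')) = fun k' => v (i, k') := by
      intro z i hi; funext k'; simp [hi]
    have h3 : ∀ z : Cn d, ∏ i : Fin d, a (fun k' => Function.update v (j, k) z (i, k'))
        = a (Function.update (fun k' => v (j, k')) k z)
          * ∏ i ∈ Finset.univ.erase j, a (fun k' => v (i, k')) := by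
      intro z
      rw [← Finset.mul_prod_erase _ _ (Finset.mem_univ j), h1]
      congr 1
      exact Finset.prod_congr rfl fun i hi => by rw [h2 z i (Finset.ne_of_mem_erase hi)]
    rw [h3, h3, a.map_update_smul, smul_mul_assoc]

/-- The `d`-fold wedge power `a ∧ ⋯ ∧ a` of a 2-form on `ℂ^d`:
`(v_{jk}) ↦ 2^{-d} ∑_π sign(π) ∏_j a (v_{π(j,0)}, v_{π(j,1)})`. -/
def twoFormWedgePow {d : ℕ} (a : Cn d [⋀^Fin 2]→L[ℝ] ℝ) : Cn d [⋀^Fin d × Fin 2]→ₗ[ℝ] ℝ :=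
  ((2 : ℝ) ^ d)⁻¹ • MultilinearMap.alternatization (twoFormTensorPow a)

end PointwisePower

/-- The top-degree form `ω^d = ω ∧ ⋯ ∧ ω`. -/
def topPow {d : ℕ} {X : Type*} (ω : TwoForm d X) : TopForm d X := fun x => twoFormWedgePow (ω x)

/-- The quotient function `τ / κ` of two top-degree forms. -/
def formRatio {d : ℕ} {X : Type*} (τ κ : TopForm d X) (x : X) : ℝ :=
  τ x (stdFrame d) / κ x (stdFrame d)

section Manifold

variable {d : ℕ} {X : Type*} [TopologicalSpace X] [ChartedSpace (Cn d) X]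

/-- The differential of the inverse of the preferred chart at `c`, as a map from the coordinate space. -/
def chartFrame (c : X) (y : Cn d) : Cn d →L[ℝ] Cn d :=
  mfderiv 𝓘(ℝ, Cn d) 𝓘(ℝ, Cn d) (chartAt (Cn d) c).symm y

/-- The 2-form `ω` in the coordinates of the preferred chart at `c` (meaningful on the chart's target). -/
def localForm (ω : TwoForm d X) (c : X) (y : Cn d) : Cn d [⋀^Fin 2]→L[ℝ] ℝ :=
  (ω ((chartAt (Cn d) c).symm y)).compContinuousLinearMap (chartFrame c y)

/-- The coefficient of the top form `τ` with respect to `dx₁ ∧ dy₁ ∧ ⋯ ∧ dx_d ∧ dy_d` in the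
preferred chart at `c` (meaningful on the chart's target). -/
def localDensity (τ : TopForm d X) (c : X) (y : Cn d) : ℝ :=
  τ ((chartAt (Cn d) c).symm y) (fun p => chartFrame c y (stdFrame d p))

/-- Smoothness of a form of top degree. -/
def SmoothTopForm (τ : TopForm d X) : Prop :=
  ∀ c : X, ContDiffOn ℝ (⊤ : ℕ∞) (localDensity τ c) (chartAt (Cn d) c).target

/-- `ω` is a Kähler form: a smooth closed real `(1,1)`-form that is positive definite. -/
structure IsKahlerForm (ω : TwoForm d X) : Prop where
  smooth : ∀ c : X, ContDiffOn ℝ (⊤ : ℕ∞) (localForm ω c) (chartAt (Cn d) c).target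
  closed : ∀ c : X, ∀ y ∈ (chartAt (Cn d) c).target, extDeriv (localForm ω c) y = 0
  invariant : ∀ (x : X) (v w : Cn d), ω x ![Complex.I • v, Complex.I • w] = ω x ![v, w]
  positive : ∀ (x : X) (v : Cn d), v ≠ 0 → 0 < ω x ![v, Complex.I • v]

/-- The squared length `ω(v, Jv)` of a tangent vector in the metric of a Kähler form `ω`. -/
def kahlerSq {X : Type*} (ω : TwoForm d X) (x : X) (v : Cn d) : ℝ := ω x ![v, Complex.I • v]

/-- The length of a curve `γ : [0,1] → X` in the metric of `ω`. -/
def kahlerLength (ω : TwoForm d X) (γ : ℝ → X) : ENNReal :=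
  ∫⁻ t in Ioo (0 : ℝ) 1,
    ENNReal.ofReal (√(kahlerSq ω (γ t) (mfderiv 𝓘(ℝ, ℝ) 𝓘(ℝ, Cn d) γ t (1 : ℝ))))

/-- The distance of the metric of `ω`: the infimum of the lengths of `C¹` curves. -/
def kahlerDist (ω : TwoForm d X) (x y : X) : ENNReal :=
  ⨅ (γ : ℝ → X) (_ : ContMDiffOn 𝓘(ℝ, ℝ) 𝓘(ℝ, Cn d) 1 γ (Icc 0 1) ∧ γ 0 = x ∧ γ 1 = y),
    kahlerLength ω γ

/-- Completeness of the metric of `ω`. -/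
def IsCompleteKahler (ω : TwoForm d X) : Prop :=
  ∀ u : ℕ → X, (∀ ε : ENNReal, 0 < ε → ∃ N, ∀ i ≥ N, ∀ j ≥ N, kahlerDist ω (u i) (u j) < ε) →
    ∃ x, Tendsto u atTop (𝓝 x)

/-- A second countable manifold is covered by a sequence of preferred charts. -/
theorem exists_chartSeq (d : ℕ) (X : Type*) [TopologicalSpace X] [ChartedSpace (Cn d) X]
    [SecondCountableTopology X] [Nonempty X] :
    ∃ c : ℕ → X, ⋃ k, (chartAt (Cn d) (c k)).source = univ := by
  obtain ⟨s, hs, hc⟩ := TopologicalSpace.countable_cover_nhds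
    (f := fun x : X => (chartAt (Cn d) x).source) (fun x => chart_source_mem_nhds (Cn d) x)
  have hne : s.Nonempty := by
    by_contra h
    rw [not_nonempty_iff_eq_empty] at h
    subst h
    simp only [mem_empty_iff_false, iUnion_of_empty, iUnion_empty] at hc
    exact empty_ne_univ hc
  obtain ⟨c, rfl⟩ := hs.exists_eq_range hne
  exact ⟨c, by simpa using hc⟩

/-- A sequence of points whose preferred charts cover `X`. -/
def chartSeq (d : ℕ) (X : Type*) [TopologicalSpace X] [ChartedSpace (Cn d) X]
    [SecondCountableTopology X] [Nonempty X] : ℕ → X := (exists_chartSeq d X).choose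

/-- The disjoint pieces `U_k ∖ (U_0 ∪ ⋯ ∪ U_{k-1})` of `X`, where `U_k` is the domain of the `k`-th
chart, seen in the coordinates of that chart. -/
def chartPiece (d : ℕ) (X : Type*) [TopologicalSpace X] [ChartedSpace (Cn d) X]
    [SecondCountableTopology X] [Nonempty X] (k : ℕ) : Set (Cn d) :=
  (chartAt (Cn d) (chartSeq d X k)).target ∩ (chartAt (Cn d) (chartSeq d X k)).symm ⁻¹'
    disjointed (fun k => (chartAt (Cn d) (chartSeq d X k)).source) k

variable [SecondCountableTopology X] [Nonempty X] [MeasurableSpace X]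

/-- The positive part of the top form `τ` as a measure on `X` (which carries its complex orientation):
on each piece of `X` it is `max (f, 0)` times Lebesgue measure in the coordinates of a chart, where
`f` is the coefficient of `τ`.  For a positive form, such as `ω^d`, this is the measure of `τ`. -/
def formMeasure (τ : TopForm d X) : Measure X :=
  Measure.sum fun k =>
    Measure.map (chartAt (Cn d) (chartSeq d X k)).symm
      ((volume.restrict (chartPiece d X k)).withDensity
        fun y => ENNReal.ofReal (localDensity τ (chartSeq d X k) y))

/-- The top form `τ` is (absolutely) integrable over `X`. -/
def FormIntegrable (τ : TopForm d X) : Prop :=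
  formMeasure τ univ < ⊤ ∧ formMeasure (-τ) univ < ⊤

/-- The integral of a top form over `X` (meaningful for integrable forms). -/
def formIntegral (τ : TopForm d X) : ℝ :=
  (formMeasure τ univ).toReal - (formMeasure (-τ) univ).toReal

end Manifold

/-- A weak `β`-ALG Kähler `(m+1)`-fold `(X, ω)` together with its structure at infinity.
`Φ` is the diffeomorphism from `(ℂ × Y)/⟨σ⟩` minus a compact set onto `X` minus a compact set, written as
a map on the cover `ℂ × Y`; `K'` is the preimage in `ℂ × Y` of the compact set removed from the quotient. -/
structure WeakALG {m : ℕ} {X Y : Type*} [TopologicalSpace X] [ChartedSpace (Cn (m + 1)) X]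
    [TopologicalSpace Y] [ChartedSpace (Cn m) Y] (β : ℝ) (ω : TwoForm (m + 1) X) where
  kahler : IsKahlerForm ω
  complete : IsCompleteKahler ω
  noncompact : NoncompactSpace X
  /-- the Kähler form `ω_Y` of the closed manifold `Y` -/
  ωY : TwoForm m Y
  kahlerY : IsKahlerForm ωY
  /-- the automorphism of `Y` -/
  σ : Equiv.Perm Y
  σ_holomorphic : ContMDiff 𝓘(ℂ, Cn m) 𝓘(ℂ, Cn m) (⊤ : WithTop ℕ∞) σ
  σ_finiteOrder : 0 < orderOf σ
  σ_invariant : ∀ y : Y, (ωY (σ y)).compContinuousLinearMap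
    (mfderiv 𝓘(ℝ, Cn m) 𝓘(ℝ, Cn m) σ y : Cn m →L[ℝ] Cn m) = ωY y
  /-- the root of unity by which `σ` acts on `ℂ` -/
  ζ : ℂ
  ζ_primitive : IsPrimitiveRoot ζ (orderOf σ)
  K : Set X
  K_compact : IsCompact K
  K' : Set (ℂ × Y)
  K'_compact : IsCompact K'
  K'_invariant : ∀ p : ℂ × Y, (ζ * p.1, σ p.2) ∈ K' ↔ p ∈ K'
  Φ : ℂ × Y → X
  Φ_image : Φ '' K'ᶜ = Kᶜ
  Φ_eq_iff : ∀ p ∈ K'ᶜ, ∀ q ∈ K'ᶜ,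
    Φ p = Φ q ↔ ∃ k : ℕ, q = (ζ ^ k * p.1, (σ ^ k) p.2)
  Φ_smooth : ContMDiffOn (𝓘(ℝ, ℂ).prod 𝓘(ℝ, Cn m)) 𝓘(ℝ, Cn (m + 1)) (⊤ : ℕ∞) Φ K'ᶜ
  Φ_localDiffeo : ∀ p ∈ K'ᶜ, Function.Bijective
    (mfderiv (𝓘(ℝ, ℂ).prod 𝓘(ℝ, Cn m)) 𝓘(ℝ, Cn (m + 1)) Φ p)
  /-- The composition of `Φ⁻¹` with the projection to `ℂ/⟨σ⟩` is holomorphic; `z ↦ z^n`, where `n` is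
  the order of `σ`, is the holomorphic coordinate of `ℂ/⟨σ⟩`. -/
  projection_holomorphic : ∃ h : X → ℂ, MDifferentiableOn 𝓘(ℂ, Cn (m + 1)) 𝓘(ℂ, ℂ) h Kᶜ ∧
    ∀ p ∈ K'ᶜ, h (Φ p) = p.1 ^ orderOf σ
  /-- the radial scaling factor is `lam ^ 2` -/
  lam : ℝ
  lam_pos : 0 < lam
  /-- `Φ^* ω` is quasi-isometric to the model `(i/2) lam² |z|^{2β-2} dz ∧ dz̄ + ω_Y`, as metrics. -/
  quasiIsometric : ∃ C : ℝ, 0 < C ∧ ∀ p ∈ K'ᶜ, ∀ (a : ℂ) (v : Cn m),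
    (lam ^ 2 * ‖p.1‖ ^ (2 * β - 2) * ‖a‖ ^ 2 + kahlerSq ωY p.2 v) / C
        ≤ kahlerSq ω (Φ p)
          (mfderiv (𝓘(ℝ, ℂ).prod 𝓘(ℝ, Cn m)) 𝓘(ℝ, Cn (m + 1)) Φ p (a, v)) ∧
      kahlerSq ω (Φ p) (mfderiv (𝓘(ℝ, ℂ).prod 𝓘(ℝ, Cn m)) 𝓘(ℝ, Cn (m + 1)) Φ p (a, v))
        ≤ C * (lam ^ 2 * ‖p.1‖ ^ (2 * β - 2) * ‖a‖ ^ 2 + kahlerSq ωY p.2 v)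

namespace WeakALG

variable {m : ℕ} {X Y : Type*} [TopologicalSpace X] [ChartedSpace (Cn (m + 1)) X]
  [TopologicalSpace Y] [ChartedSpace (Cn m) Y] {β : ℝ} {ω : TwoForm (m + 1) X}

/-- `Q` is a quasi-isometry constant, at least 10, between `Φ^* ω` and the normalized model
`(i/2) |z|^{2β-2} dz ∧ dz̄ + ω_Y = (i/2) |u|^{-2-2β} du ∧ dū + ω_Y`, `u = 1/z`, on `{|z| > R}`. -/
def IsQuasiConstant (A : WeakALG (Y := Y) β ω) (R Q : ℝ) : Prop :=
  10 ≤ Q ∧ ∀ p : ℂ × Y, R < ‖p.1‖ → ∀ (a : ℂ) (v : Cn m),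
    (‖p.1‖ ^ (2 * β - 2) * ‖a‖ ^ 2 + kahlerSq A.ωY p.2 v) / Q
        ≤ kahlerSq ω (A.Φ p)
          (mfderiv (𝓘(ℝ, ℂ).prod 𝓘(ℝ, Cn m)) 𝓘(ℝ, Cn (m + 1)) A.Φ p (a, v)) ∧
      kahlerSq ω (A.Φ p) (mfderiv (𝓘(ℝ, ℂ).prod 𝓘(ℝ, Cn m)) 𝓘(ℝ, Cn (m + 1)) A.Φ p (a, v))
        ≤ Q * (‖p.1‖ ^ (2 * β - 2) * ‖a‖ ^ 2 + kahlerSq A.ωY p.2 v)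

/-- `η` is the 2-form on `X` that equals `s χ(ρ t) (i/2) du ∧ dū`, `u = 1/z`, `ρ = |u|`, on the part
`{|z| > R}` of the end (as an equation between the pull-backs to the cover) and vanishes elsewhere. -/
def IsBumpForm (A : WeakALG (Y := Y) β ω) (R : ℝ) (χ : ℝ → ℝ) (t s : ℝ)
    (η : TwoForm (m + 1) X) : Prop :=
  (∀ p : ℂ × Y, R < ‖p.1‖ →
    (η (A.Φ p)).compContinuousLinearMap
        (mfderiv (𝓘(ℝ, ℂ).prod 𝓘(ℝ, Cn m)) 𝓘(ℝ, Cn (m + 1)) A.Φ p : ℂ × Cn m →L[ℝ] Cn (m + 1))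
      = (s * χ (‖p.1⁻¹‖ * t)) • areaForm.compContinuousLinearMap
        (mfderiv (𝓘(ℝ, ℂ).prod 𝓘(ℝ, Cn m)) 𝓘(ℝ, ℂ) (fun q : ℂ × Y => q.1⁻¹) p :
          ℂ × Cn m →L[ℝ] ℂ)) ∧
  ∀ x : X, x ∉ A.Φ '' {p | R < ‖p.1‖} → η x = 0

/-- The Riemannian volume `∫_Y ω_Y^m / m!` of the fibre. -/
def volY [SecondCountableTopology Y] [Nonempty Y] [MeasurableSpace Y]
    (A : WeakALG (Y := Y) β ω) : ℝ :=
  formIntegral (topPow A.ωY) / (m.factorial : ℝ)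

/-- The threshold
`t₀ = max {10 R, [1000 · 32^{2+2β} Q^d n |∫_X (ω^d - Υ)| / (2π d! Vol(Y) ∫_0^∞ χ(y) y dy)]^{1/(2β)}}`,
where `d = m + 1` is the dimension of `X` and `n` is the order of `σ`. -/
def threshold [SecondCountableTopology X] [Nonempty X] [MeasurableSpace X]
    [SecondCountableTopology Y] [Nonempty Y] [MeasurableSpace Y]
    (A : WeakALG (Y := Y) β ω) (Υ : TopForm (m + 1) X) (χ : ℝ → ℝ) (R Q : ℝ) : ℝ :=
  max (10 * R)
    ((1000 * (32 : ℝ) ^ (2 + 2 * β) * Q ^ (m + 1) * (orderOf A.σ : ℝ)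
        * |formIntegral (topPow ω - Υ)|
      / (2 * Real.pi * ((m + 1).factorial : ℝ) * A.volY * ∫ y in Ioi (0 : ℝ), χ y * y))
      ^ (1 / (2 * β)))

end WeakALG

/-- A standard cutoff function: smooth with values in `[0,1]`, equal to 1 on `[2,3]`, and 0 on
`(-∞,1]` and on `[4,∞)`. -/
structure IsStandardCutoff (χ : ℝ → ℝ) : Prop where
  smooth : ContDiff ℝ (⊤ : ℕ∞) χ
  mem_Icc : ∀ y, χ y ∈ Icc (0 : ℝ) 1
  eq_one : ∀ y ∈ Icc (2 : ℝ) 3, χ y = 1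
  eq_zero : ∀ y, y ≤ 1 ∨ 4 ≤ y → χ y = 0

end

/-!
The end of `X` is a bundle over the end of `ℂ/⟨σ⟩`, and the bump form lives on the base: if `h` is
the holomorphic projection, with `h (Φ (z, y)) = z ^ n`, then `η` is `s` times the pull-back by `h`
of `g(w) dx ∧ dy` for a smooth compactly supported function `g` on `ℂ` (`bumpProfile`, `unitBump`).
Hence `η` is smooth, closed and of type `(1,1)` (`contDiffAt_localForm_pullbackForm`). It has
compact support because `Y` is compact, and it is positive definite when added to `ω` as soon as
`|s| Q < (t/4) ^ (2β+2)`, by the lower half of the quasi-isometry (`isKahlerForm_add_unitBump`).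

Pointwise, `ω` and `η` can be diagonalized simultaneously, and `η` has rank 2, so that
`(ω + η) ^ d = (1 + s b) ω ^ d` with a nonnegative continuous compactly supported function `b`
(`twoFormWedgePow_add_pullback`, `formRatio_add_smul_unitBump`). With `D = ∫ (ω ^ d - Υ)` and
`I = ∫ b ω ^ d`, the total mass of `(ω + η) ^ d - Υ` is `D + s I`; so `s = -D / I` is the parameter
wanted, and it remains to see that `I` is so large that this `s` satisfies the positivity condition.

The lower bound (`integral_bumpDensity_ge`) is obtained by integrating over the part of the annulus
`{t/3 < |z| < t/2}`, on which the cutoff is 1, in a sector of angle `2π/n`. Times `Y` it embeds in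
`X`, since the sector meets each orbit of the `n`-th roots of unity at most once. There `b ω ^ d` is
`d` times the wedge product of `(i/2) du ∧ dū` and `ω ^ (d-1)`, in which only the restriction of `ω`
to the fibres counts; that restriction is at least `ω_Y / Q`, hence its top power is at least
`ω_Y ^ (d-1) / Q ^ (d-1)` (`wedgePow_fibre_comparison`). The comparison of top powers is one of
determinants: a real linear map of `ℂ^m` that does not shrink lengths by more than `√Q` has
determinant at least `Q ^ (-m)` in absolute value (`inv_pow_le_abs_det`), because it maps the unit
ball onto a set containing a ball of radius `1/√Q`. The remaining inequality is
`abs_div_mul_lt_of_threshold_lt`.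

Integrals of top forms are measured with respect to `ω ^ d`: for every top form `τ`, the integral of
`τ` is the integral of the function `τ / ω ^ d` for the measure of `ω ^ d`
(`formIntegral_eq_integral`), and the change of variables formula for injective parametrizations
(`setLIntegral_image_formMeasure`) makes that measure independent of the charts used to define it;
in particular it is finite on compact sets.
-/

noncomputable section

/-! ### Positive `(1,1)`-forms on `ℂ^d` -/

theorem areaForm_apply (v : Fin 2 → ℂ) :
    areaForm v = (v 0).re * (v 1).im - (v 1).re * (v 0).im := by
  rw [areaForm, ContinuousMultilinearMap.alternatization_apply_apply]
  have h : (Finset.univ : Finset (Equiv.Perm (Fin 2))) = {1, Equiv.swap 0 1} := by decide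
  rw [h, Finset.sum_pair (by decide)]
  simp [Fin.prod_univ_two, sub_eq_add_neg]

theorem areaForm_mul_left (c : ℂ) (v : Fin 2 → ℂ) :
    areaForm (fun k => c * v k) = ‖c‖ ^ 2 * areaForm v := by
  simp only [areaForm_apply, ← Complex.normSq_eq_norm_sq, Complex.normSq_apply, Complex.mul_re,
    Complex.mul_im]
  ring

theorem areaForm_I (a b : ℂ) : areaForm ![Complex.I * a, Complex.I * b] = areaForm ![a, b] := by
  simp [areaForm_apply]; ring

theorem areaForm_self_I (a : ℂ) : areaForm ![a, Complex.I * a] = ‖a‖ ^ 2 := by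
  simp [areaForm_apply, ← Complex.normSq_eq_norm_sq, Complex.normSq_apply]

/-- `stdFrame d`, as a real basis of `ℂ^d`. -/
def stdBasis (d : ℕ) : Module.Basis (Fin d × Fin 2) ℝ (Cn d) :=
  (Pi.basis fun _ : Fin d => Complex.basisOneI).reindex (Equiv.sigmaEquivProd _ _)

theorem coe_stdBasis (d : ℕ) : ⇑(stdBasis d) = stdFrame d := by
  funext p
  obtain ⟨j, k⟩ := p
  fin_cases k <;> simp [stdBasis, stdFrame]

/-- A form of top degree is determined by its value on the standard frame, and pulls back by the
determinant. -/
theorem topForm_comp_stdFrame {d : ℕ} (τ : Cn d [⋀^Fin d × Fin 2]→ₗ[ℝ] ℝ)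
    (f : Cn d →ₗ[ℝ] Cn d) :
    τ (fun p => f (stdFrame d p)) = LinearMap.det f * τ (stdFrame d) := by
  have h := τ.eq_smul_basis_det (stdBasis d)
  have h2 : τ (fun p => f (stdFrame d p)) = τ (stdBasis d) * (stdBasis d).det (f ∘ stdBasis d) := by
    conv_lhs => rw [h]
    simp [coe_stdBasis, Function.comp_def]
  rw [h2, Module.Basis.det_comp, coe_stdBasis, ← coe_stdBasis, Module.Basis.det_self]
  ring

theorem det_restrictScalars_complex {V : Type*} [AddCommGroup V] [Module ℂ V]
    (f : V →ₗ[ℂ] V) :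
    LinearMap.det (f.restrictScalars ℝ) = ‖LinearMap.det f‖ ^ 2 := by
  rw [LinearMap.det_restrictScalars, Algebra.norm_complex_eq]
  simp [Complex.normSq_eq_norm_sq]

theorem twoFormWedgePow_apply {d : ℕ} (a : Cn d [⋀^Fin 2]→L[ℝ] ℝ) (v : Fin d × Fin 2 → Cn d) :
    twoFormWedgePow a v = ((2 : ℝ) ^ d)⁻¹ * ∑ π : Equiv.Perm (Fin d × Fin 2),
      (Equiv.Perm.sign π : ℝ) * ∏ j : Fin d, a (fun k => v (π (j, k))) := by
  simp only [twoFormWedgePow, AlternatingMap.smul_apply, MultilinearMap.alternatization_apply,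
    smul_eq_mul, MultilinearMap.domDomCongr_apply, twoFormTensorPow,
    MultilinearMap.coe_mk]
  congr 1
  refine Finset.sum_congr rfl fun π _ => ?_
  rw [Units.smul_def, zsmul_eq_mul]

theorem twoFormWedgePow_comp {d : ℕ} (a : Cn d [⋀^Fin 2]→L[ℝ] ℝ) (f : Cn d →L[ℝ] Cn d)
    (v : Fin d × Fin 2 → Cn d) :
    twoFormWedgePow (a.compContinuousLinearMap f) v = twoFormWedgePow a (fun p => f (v p)) := by
  simp only [twoFormWedgePow_apply, ContinuousAlternatingMap.compContinuousLinearMap_apply]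
  rfl

/-- The permutation `(j, k) ↦ (ρ j, τ_j k)` of `Fin d × Fin 2`. -/
def blockPerm {d : ℕ} (q : Equiv.Perm (Fin d) × (Fin d → Equiv.Perm (Fin 2))) :
    Equiv.Perm (Fin d × Fin 2) :=
  (Equiv.prodCongrRight q.2).trans (Equiv.prodCongrLeft fun _ => q.1)

theorem blockPerm_apply {d : ℕ} (q : Equiv.Perm (Fin d) × (Fin d → Equiv.Perm (Fin 2)))
    (j : Fin d) (k : Fin 2) : blockPerm q (j, k) = (q.1 j, q.2 j k) := rfl

theorem sign_blockPerm {d : ℕ} (q : Equiv.Perm (Fin d) × (Fin d → Equiv.Perm (Fin 2))) :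
    Equiv.Perm.sign (blockPerm q) = ∏ j, Equiv.Perm.sign (q.2 j) := by
  rw [blockPerm, Equiv.Perm.sign_trans]
  rw [Equiv.Perm.sign_prodCongrRight, Equiv.Perm.sign_prodCongrLeft]
  simp

theorem blockPerm_injective {d : ℕ} : Function.Injective (blockPerm (d := d)) := by
  intro q q' h
  have h' : ∀ j k, (q.1 j, q.2 j k) = (q'.1 j, q'.2 j k) := fun j k => by
    rw [← blockPerm_apply, ← blockPerm_apply, h]
  ext j k
  · exact congrArg Fin.val (congrArg Prod.fst (h' j 0))
  · exact congrArg Fin.val (congrArg Prod.snd (h' j k))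

/-- The permutations that preserve the partition of `Fin d × Fin 2` into pairs are the
`blockPerm`s. -/
theorem exists_blockPerm {d : ℕ} (π : Equiv.Perm (Fin d × Fin 2))
    (h : ∀ j, (π (j, 0)).1 = (π (j, 1)).1) : ∃ q, blockPerm q = π := by
  have hfst : ∀ j k, (π (j, k)).1 = (π (j, 0)).1 := by
    intro j k; fin_cases k
    · rfl
    · exact (h j).symm
  have hτ : ∀ j, Function.Injective fun k => (π (j, k)).2 := by
    intro j k k' hk
    have : π (j, k) = π (j, k') := Prod.ext (by rw [hfst j k, hfst j k']) hk
    simpa using this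
  have hρ : Function.Surjective fun j => (π (j, 0)).1 := by
    intro i
    obtain ⟨⟨j, k⟩, hjk⟩ := π.surjective (i, 0)
    exact ⟨j, by simp only; rw [← hfst j k, hjk]⟩
  refine ⟨(Equiv.ofBijective _ (Finite.surjective_iff_bijective.1 hρ),
    fun j => Equiv.ofBijective _ (Finite.injective_iff_bijective.1 (hτ j))), ?_⟩
  ext1 ⟨j, k⟩
  rw [blockPerm_apply]
  exact Prod.ext (hfst j k).symm rfl

/-- The top power of `∑ j, c j • (dx_j ∧ dy_j)` is `d! ∏ c_j` times the standard volume form. -/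
theorem twoFormWedgePow_diag {d : ℕ} (a : Cn d [⋀^Fin 2]→L[ℝ] ℝ) (c : Fin d → ℝ)
    (ha : ∀ v w, a ![v, w] = ∑ j, c j * areaForm ![v j, w j]) :
    twoFormWedgePow a (stdFrame d) = d.factorial * ∏ j, c j := by
  have ha' : ∀ v : Fin 2 → Cn d, a v = ∑ j, c j * areaForm ![v 0 j, v 1 j] := by
    intro v
    rw [← ha]
    congr 1; ext k; fin_cases k <;> rfl
  have hoff : ∀ p q : Fin d × Fin 2, p.1 ≠ q.1 → a ![stdFrame d p, stdFrame d q] = 0 := by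
    intro p q hpq
    rw [ha]
    refine Finset.sum_eq_zero fun j _ => ?_
    rcases ne_or_eq p.1 j with h | h
    · have : stdFrame d p j = 0 := by
        unfold stdFrame; split_ifs <;> simp [h.symm]
      simp [areaForm_apply, this]
    · have : stdFrame d q j = 0 := by
        have h' : j ≠ q.1 := h ▸ hpq
        unfold stdFrame; split_ifs <;> simp [h']
      simp [areaForm_apply, this]
  have hon : ∀ (i : Fin d) (τ : Equiv.Perm (Fin 2)),
      a (fun k => stdFrame d (i, τ k)) = (Equiv.Perm.sign τ : ℝ) * c i := by
    intro i τ
    have h1 : a (fun k => stdFrame d (i, k)) = c i := by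
      rw [ha', Finset.sum_eq_single i]
      · simp [areaForm_apply, stdFrame]
      · intro j _ hj
        simp [areaForm_apply, stdFrame, hj]
      · simp
    have := a.toAlternatingMap.map_perm (fun k => stdFrame d (i, k)) τ
    simp only [ContinuousAlternatingMap.coe_toAlternatingMap, Function.comp_def] at this
    rw [this, h1, Units.smul_def, zsmul_eq_mul]
  rw [twoFormWedgePow_apply]
  have hsum : ∑ π : Equiv.Perm (Fin d × Fin 2),
      (Equiv.Perm.sign π : ℝ) * ∏ j : Fin d, a (fun k => stdFrame d (π (j, k)))
      = ∑ q : Equiv.Perm (Fin d) × (Fin d → Equiv.Perm (Fin 2)), ∏ j, c j := by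
    symm
    refine Finset.sum_of_injOn blockPerm blockPerm_injective.injOn (by simp) ?_ ?_
    · intro π _ hπ
      by_cases h : ∀ j, (π (j, 0)).1 = (π (j, 1)).1
      · obtain ⟨q, rfl⟩ := exists_blockPerm π h
        simp at hπ
      · push Not at h
        obtain ⟨j, hj⟩ := h
        rw [Finset.prod_eq_zero (Finset.mem_univ j), mul_zero]
        rw [← hoff _ _ hj]
        congr 1; ext k; fin_cases k <;> rfl
    · intro q _
      simp only [blockPerm_apply, hon, sign_blockPerm]
      rw [Finset.prod_mul_distrib, Equiv.prod_comp q.1 c, ← mul_assoc]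
      have : ((∏ j, Equiv.Perm.sign (q.2 j) : ℤˣ) : ℝ)
          * ∏ j, ((Equiv.Perm.sign (q.2 j) : ℤ) : ℝ) = 1 := by
        rw [Units.coe_prod, Int.cast_prod, ← Finset.prod_mul_distrib]
        refine Finset.prod_eq_one fun j _ => ?_
        rcases Int.units_eq_one_or (Equiv.Perm.sign (q.2 j)) with h | h <;> simp [h]
      rw [this, one_mul]
  rw [hsum]
  simp [Fintype.card_perm]
  field_simp

/-- A real 2-form `a` on a complex vector space is positive if it is of type `(1,1)` and
`a (v, iv) > 0` for `v ≠ 0`. -/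
structure IsPositiveForm {d : ℕ} (a : Cn d [⋀^Fin 2]→L[ℝ] ℝ) : Prop where
  invariant : ∀ v w : Cn d, a ![Complex.I • v, Complex.I • w] = a ![v, w]
  positive : ∀ v : Cn d, v ≠ 0 → 0 < a ![v, Complex.I • v]

theorem IsKahlerForm.isPositiveForm {d : ℕ} {X : Type*} [TopologicalSpace X]
    [ChartedSpace (Cn d) X] {ω : TwoForm d X} (h : IsKahlerForm ω) (x : X) :
    IsPositiveForm (ω x) := ⟨h.invariant x, h.positive x⟩

theorem twoForm_add_left {d : ℕ} (a : Cn d [⋀^Fin 2]→L[ℝ] ℝ) (v v' w : Cn d) :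
    a ![v + v', w] = a ![v, w] + a ![v', w] := by
  have e : ∀ z, Function.update ![v, w] 0 z = ![z, w] := fun z => by ext k; fin_cases k <;> simp
  simpa only [e] using a.map_update_add ![v, w] 0 v v'

theorem twoForm_smul_left {d : ℕ} (a : Cn d [⋀^Fin 2]→L[ℝ] ℝ) (r : ℝ) (v w : Cn d) :
    a ![r • v, w] = r * a ![v, w] := by
  have e : ∀ z, Function.update ![v, w] 0 z = ![z, w] := fun z => by ext k; fin_cases k <;> simp
  simpa only [e, smul_eq_mul] using a.map_update_smul ![v, w] 0 r v

theorem twoForm_swap {d : ℕ} (a : Cn d [⋀^Fin 2]→L[ℝ] ℝ) (v w : Cn d) :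
    a ![v, w] = - a ![w, v] := by
  have := a.toAlternatingMap.map_swap ![w, v] (i := 0) (j := 1) (by simp)
  have e : ![w, v] ∘ ⇑(Equiv.swap (0 : Fin 2) 1) = ![v, w] := by
    ext k; fin_cases k <;> simp
  rwa [e] at this

theorem twoForm_neg_left {d : ℕ} (a : Cn d [⋀^Fin 2]→L[ℝ] ℝ) (v w : Cn d) :
    a ![-v, w] = -a ![v, w] := by
  simpa using twoForm_smul_left a (-1) v w

theorem twoForm_self {d : ℕ} (a : Cn d [⋀^Fin 2]→L[ℝ] ℝ) (v : Cn d) :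
    a ![v, v] = 0 := a.map_eq_zero_of_eq ![v, v] (i := 0) (j := 1) (by simp) (by simp)

/-- The Hermitian inner product `a (v, iw) + i a (v, w)` of a positive form `a`. -/
abbrev IsPositiveForm.core {d : ℕ} {a : Cn d [⋀^Fin 2]→L[ℝ] ℝ} (h : IsPositiveForm a) :
    InnerProductSpace.Core ℂ (Cn d) where
  inner v w := ⟨a ![v, Complex.I • w], a ![v, w]⟩
  conj_inner_symm v w := by
    have h1 : a ![w, Complex.I • v] = a ![v, Complex.I • w] := by
      rw [← h.invariant w, twoForm_swap, smul_smul, Complex.I_mul_I, neg_one_smul,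
        twoForm_neg_left, neg_neg]
    apply Complex.ext
    · simpa using h1
    · simpa using (twoForm_swap a v w).symm
  re_inner_nonneg v := by
    rcases eq_or_ne v 0 with rfl | hv
    · have := twoForm_smul_left a 0 0 (Complex.I • 0)
      simp at this
      simp [this]
    · exact (h.positive v hv).le
  add_left v v' w := by
    apply Complex.ext <;> simp [twoForm_add_left]
  smul_left v w r := by
    have hI : ∀ w', a ![Complex.I • v, w'] = - a ![v, Complex.I • w'] := by
      intro w'
      rw [← h.invariant, smul_smul, Complex.I_mul_I, neg_one_smul,
        twoForm_neg_left]
    have hr : r • v = r.re • v + r.im • (Complex.I • v) := by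
      rw [← Complex.coe_smul, ← Complex.coe_smul, smul_smul, ← add_smul, Complex.re_add_im]
    have h1 : ∀ w', a ![v, -w'] = - a ![v, w'] := by
      intro w'
      rw [twoForm_swap, twoForm_neg_left, twoForm_swap a v]
    apply Complex.ext
    · simp [hr, twoForm_add_left, twoForm_smul_left, hI, smul_smul, Complex.I_mul_I, h1]
    · simp [hr, twoForm_add_left, twoForm_smul_left, hI]
  definite v hv := by
    by_contra hne
    exact (h.positive v hne).ne' (congrArg Complex.re hv)

/-- In a finite-dimensional complex inner product space, a linear functional is a multiple of the
first coordinate of some orthonormal basis. -/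
theorem exists_orthonormalBasis_adapted {E : Type*} [NormedAddCommGroup E] [InnerProductSpace ℂ E]
    [FiniteDimensional ℂ E] {m : ℕ} (hE : Module.finrank ℂ E = m + 1) (ℓ : E →ₗ[ℂ] ℂ) :
    ∃ (b : OrthonormalBasis (Fin (m + 1)) ℂ E) (r : ℝ),
      0 ≤ r ∧ ∀ v : Fin (m + 1) → ℂ, ℓ (∑ j, v j • b j) = r * v 0 := by
  obtain ⟨w, hw⟩ := (InnerProductSpace.toDual ℂ E).surjective (LinearMap.toContinuousLinearMap ℓ)
  have hℓ : ∀ v, ℓ v = inner ℂ w v := fun v => by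
    rw [← InnerProductSpace.toDual_apply_apply, hw]; rfl
  rcases eq_or_ne w 0 with rfl | hne
  · refine ⟨(stdOrthonormalBasis ℂ E).reindex (finCongr hE), 0, le_rfl, fun v => ?_⟩
    simp [hℓ]
  · have hn : ‖w‖ ≠ 0 := norm_ne_zero_iff.2 hne
    obtain ⟨b, hb⟩ := Orthonormal.exists_orthonormalBasis_extension_of_card_eq (𝕜 := ℂ)
      (v := fun _ : Fin (m + 1) => ((‖w‖⁻¹ : ℝ) : ℂ) • w) (s := {0}) (by simpa using hE) (by
        constructor
        · intro i
          simp [Set.domRestrict, norm_smul, hn]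
        · intro i j hij
          exact absurd (Subsingleton.elim i j) hij)
    refine ⟨b, ‖w‖, norm_nonneg _, fun v => ?_⟩
    have hwb : w = (‖w‖ : ℂ) • b 0 := by
      rw [hb 0 rfl, smul_smul, ← Complex.ofReal_mul, mul_inv_cancel₀ hn]; simp
    rw [hℓ, inner_sum]
    conv_lhs => rw [hwb]
    simp only [inner_smul_left, inner_smul_right, b.inner_eq_ite]
    simp [mul_comm]

/-- An adapted orthonormal basis for an inner product that is not the one of a normed space structure
already present. -/
theorem InnerProductSpace.Core.exists_basis_adapted {V : Type*} [AddCommGroup V] [Module ℂ V]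
    [FiniteDimensional ℂ V] {m : ℕ} (hV : Module.finrank ℂ V = m + 1)
    (c : InnerProductSpace.Core ℂ V) (ℓ : V →ₗ[ℂ] ℂ) :
    ∃ (b : Module.Basis (Fin (m + 1)) ℂ V) (r : ℝ), 0 ≤ r ∧
      (∀ v w : Fin (m + 1) → ℂ, c.inner (∑ j, v j • b j) (∑ j, w j • b j)
        = ∑ j, starRingEnd ℂ (v j) * w j) ∧
      ∀ v : Fin (m + 1) → ℂ, ℓ (∑ j, v j • b j) = r * v 0 := by
  let : NormedAddCommGroup V := c.toNormedAddCommGroup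
  let : InnerProductSpace ℂ V := InnerProductSpace.ofCore c.toCore
  obtain ⟨b, r, hr, hb⟩ := exists_orthonormalBasis_adapted hV ℓ
  refine ⟨b.toBasis, r, hr, fun v w => ?_, fun v => ?_⟩
  · simp only [OrthonormalBasis.coe_toBasis]
    exact b.orthonormal.inner_sum v w Finset.univ
  · simpa using hb v

/-- A positive form is unitarily equivalent to the standard one; the unitary frame can be adapted
to a complex linear functional. -/
theorem IsPositiveForm.exists_unitary {m : ℕ} {a : Cn (m + 1) [⋀^Fin 2]→L[ℝ] ℝ}
    (h : IsPositiveForm a) (ℓ : Cn (m + 1) →ₗ[ℂ] ℂ) :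
    ∃ (L : Cn (m + 1) ≃ₗ[ℂ] Cn (m + 1)) (r : ℝ), 0 ≤ r ∧
      (∀ v w, a ![L v, L w] = ∑ j, areaForm ![v j, w j]) ∧ ∀ v, ℓ (L v) = r * v 0 := by
  obtain ⟨b, r, hr, hb, hℓ⟩ := h.core.exists_basis_adapted (m := m) (by simp) ℓ
  refine ⟨b.equivFun.symm, r, hr, fun v w => ?_, fun v => ?_⟩
  · have := congrArg Complex.im (hb v w)
    rw [Complex.im_sum] at this
    simp only [Module.Basis.equivFun_symm_apply]
    refine this.trans (Finset.sum_congr rfl fun j _ => ?_)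
    simp [areaForm_apply]; ring
  · rw [Module.Basis.equivFun_symm_apply]
    exact hℓ v

theorem IsPositiveForm.exists_unitary' {d : ℕ} {a : Cn d [⋀^Fin 2]→L[ℝ] ℝ}
    (h : IsPositiveForm a) :
    ∃ (L : Cn d ≃ₗ[ℂ] Cn d), ∀ v w, a ![L v, L w] = ∑ j, areaForm ![v j, w j] := by
  cases d with
  | zero =>
    refine ⟨LinearEquiv.refl _ _, fun v w => ?_⟩
    rw [Subsingleton.elim v w]
    simp [twoForm_self]
  | succ m =>
    obtain ⟨L, r, -, hL, -⟩ := h.exists_unitary 0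
    exact ⟨L, hL⟩

/-- The real linear map underlying a complex linear one, as a continuous linear map. -/
abbrev realCLM {d : ℕ} (L : Cn d →ₗ[ℂ] Cn d) : Cn d →L[ℝ] Cn d :=
  (LinearMap.toContinuousLinearMap L).restrictScalars ℝ

theorem det_realCLM_pos {d : ℕ} (L : Cn d ≃ₗ[ℂ] Cn d) :
    0 < LinearMap.det ((L : Cn d →ₗ[ℂ] Cn d).restrictScalars ℝ) := by
  rw [det_restrictScalars_complex]
  have := (LinearEquiv.isUnit_det' L).ne_zero
  positivity

/-- The top power of a form that the frame `L` diagonalizes, with coefficients `c j`. -/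
theorem twoFormWedgePow_of_diag_comp {d : ℕ} {a : Cn d [⋀^Fin 2]→L[ℝ] ℝ} (L : Cn d ≃ₗ[ℂ] Cn d)
    (c : Fin d → ℝ) (ha : ∀ v w, a ![L v, L w] = ∑ j, c j * areaForm ![v j, w j]) :
    LinearMap.det ((L : Cn d →ₗ[ℂ] Cn d).restrictScalars ℝ) * twoFormWedgePow a (stdFrame d)
      = d.factorial * ∏ j, c j := by
  rw [← topForm_comp_stdFrame]
  have := twoFormWedgePow_comp a (realCLM (L : Cn d →ₗ[ℂ] Cn d)) (stdFrame d)
  rw [twoFormWedgePow_diag _ c] at this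
  · exact this.symm
  · intro v w
    rw [← ha]
    simp only [ContinuousAlternatingMap.compContinuousLinearMap_apply]
    congr 1; ext k; fin_cases k <;> rfl

theorem IsPositiveForm.wedgePow_pos {d : ℕ} {a : Cn d [⋀^Fin 2]→L[ℝ] ℝ} (h : IsPositiveForm a) :
    0 < twoFormWedgePow a (stdFrame d) := by
  obtain ⟨L, hL⟩ := h.exists_unitary'
  have := twoFormWedgePow_of_diag_comp L 1 (by simpa using hL)
  simp at this
  have h2 : (0 : ℝ) < d.factorial := by positivity
  rw [← this] at h2
  exact (pos_iff_pos_of_mul_pos h2).1 (det_realCLM_pos L)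

/-- Adding a multiple of the pull-back of the area form by a complex linear functional `ℓ` multiplies
the top power by an affine function; here `r` is the norm of `ℓ`. -/
theorem twoFormWedgePow_add_pullback {m : ℕ} {a η : Cn (m + 1) [⋀^Fin 2]→L[ℝ] ℝ}
    {ℓ : Cn (m + 1) →ₗ[ℂ] ℂ} {G r : ℝ}
    (hη : ∀ v w, η ![v, w] = G * areaForm ![ℓ v, ℓ w])
    {L : Cn (m + 1) ≃ₗ[ℂ] Cn (m + 1)}
    (hL : ∀ v w, a ![L v, L w] = ∑ j, areaForm ![v j, w j]) (hℓ : ∀ v, ℓ (L v) = r * v 0) :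
    twoFormWedgePow (a + η) (stdFrame (m + 1))
      = (1 + G * r ^ 2) * twoFormWedgePow a (stdFrame (m + 1)) := by
  have h1 := twoFormWedgePow_of_diag_comp L 1 (by simpa using hL)
  have h2 := twoFormWedgePow_of_diag_comp (a := a + η) L (Fin.cons (1 + G * r ^ 2) 1) (by
    intro v w
    rw [ContinuousAlternatingMap.add_apply, hL, hη, hℓ, hℓ]
    have : areaForm ![(r : ℂ) * v 0, r * w 0] = r ^ 2 * areaForm ![v 0, w 0] := by
      simp [areaForm_apply]; ring
    rw [this, Fin.sum_univ_succ, Fin.sum_univ_succ]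
    simp
    ring)
  rw [Fin.prod_univ_succ] at h2
  simp at h1 h2
  have := (det_realCLM_pos L).ne'
  apply mul_left_cancel₀ this
  rw [h2, ← h1]; ring

/-! ### Determinants of real linear maps that expand the fibres -/

/-- A linear map over multiplication by `k` on the first coordinate is block triangular. -/
theorem det_eq_of_fibred {m : ℕ} (N : Cn (m + 1) →ₗ[ℝ] Cn (m + 1)) (k : ℂ)
    (hN : ∀ v, N v 0 = k * v 0) (B : Cn m →ₗ[ℝ] Cn m)
    (hB : ∀ v, N (Fin.cons 0 v) = Fin.cons 0 (B v)) :
    LinearMap.det N = ‖k‖ ^ 2 * LinearMap.det B := by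
  let e := Fin.consLinearEquiv ℝ (fun _ : Fin (m + 1) => ℂ)
  let N' : (ℂ × Cn m) →ₗ[ℝ] (ℂ × Cn m) :=
    (e.symm : Cn (m + 1) →ₗ[ℝ] ℂ × Cn m) ∘ₗ N ∘ₗ (e : ℂ × Cn m →ₗ[ℝ] Cn (m + 1))
  have hdet : LinearMap.det N' = LinearMap.det N := LinearMap.det_conj N e.symm
  have h1 : ∀ p, (N' p).1 = k * p.1 := fun p => (hN (e p)).trans rfl
  have h2 : ∀ v, (N' (0, v)).2 = B v := fun v => by
    change Fin.tail (N (Fin.cons 0 v)) = _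
    rw [hB]; rfl
  let K : ℂ →ₗ[ℝ] ℂ := (LinearMap.mulLeft ℂ k).restrictScalars ℝ
  have hK : LinearMap.det K = ‖k‖ ^ 2 := by
    rw [det_restrictScalars_complex]; simp
  let b := Module.Free.chooseBasis ℝ ℂ
  let b' := Module.Free.chooseBasis ℝ (Cn m)
  have hblock : LinearMap.toMatrix (b.prod b') (b.prod b') N' = Matrix.fromBlocks
      (LinearMap.toMatrix b b K) 0
      (LinearMap.toMatrix b b' (LinearMap.snd ℝ ℂ (Cn m) ∘ₗ N' ∘ₗ LinearMap.inl ℝ ℂ (Cn m)))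
      (LinearMap.toMatrix b' b' B) := by
    ext (i | i) (j | j)
    · simp [LinearMap.toMatrix_apply, h1, K]
    · simp [LinearMap.toMatrix_apply, h1]
    · simp [LinearMap.toMatrix_apply]
    · simp [LinearMap.toMatrix_apply, h2]
  rw [← hdet, ← LinearMap.det_toMatrix (b.prod b'), hblock, Matrix.det_fromBlocks_zero₁₂,
    LinearMap.det_toMatrix, LinearMap.det_toMatrix, hK]

open scoped Pointwise in
/-- A real linear map of `ℂ^m` whose square norm expansion is at least `1/Q` has determinant at least
`Q^{-m}`: the image of the unit ball contains the ball of radius `Q^{-1/2}`. -/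
theorem inv_pow_le_abs_det {m : ℕ} (B : Cn m →ₗ[ℝ] Cn m) {Q : ℝ} (hQ : 0 < Q)
    (hB : ∀ v, (∑ j, ‖v j‖ ^ 2) / Q ≤ ∑ j, ‖B v j‖ ^ 2) :
    (Q ^ m)⁻¹ ≤ |LinearMap.det B| := by
  have hinj : Function.Injective B := by
    rw [← LinearMap.ker_eq_bot, LinearMap.ker_eq_bot']
    intro v hv
    have h := hB v
    rw [hv] at h
    simp only [Pi.zero_apply, norm_zero, ne_eq, OfNat.ofNat_ne_zero, not_false_eq_true, zero_pow,
      Finset.sum_const_zero] at h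
    have h0 : ∑ j, ‖v j‖ ^ 2 ≤ 0 := by
      rwa [div_le_iff₀ hQ, zero_mul] at h
    have h1 := (Finset.sum_eq_zero_iff_of_nonneg (fun j _ => sq_nonneg ‖v j‖)).1
      (le_antisymm h0 (Finset.sum_nonneg fun j _ => sq_nonneg _))
    funext j
    simpa using h1 j (Finset.mem_univ j)
  have hsurj : Function.Surjective B := LinearMap.injective_iff_surjective.1 hinj
  let E : Set (Cn m) := {v | ∑ j, ‖v j‖ ^ 2 < 1}
  have hEo : IsOpen E := isOpen_lt (by fun_prop) continuous_const
  have hE0 : volume E ≠ 0 := by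
    refine (hEo.measure_pos volume ⟨0, ?_⟩).ne'
    simp [E]
  have hEt : volume E ≠ ⊤ := by
    refine ((Metric.isBounded_ball (x := (0 : Cn m)) (r := 2)).subset
      fun v hv => ?_).measure_lt_top.ne
    rw [mem_ball_zero_iff, pi_norm_lt_iff (by norm_num)]
    intro j
    have : ‖v j‖ ^ 2 ≤ ∑ j, ‖v j‖ ^ 2 :=
      Finset.single_le_sum (f := fun j => ‖v j‖ ^ 2) (fun j _ => sq_nonneg _) (Finset.mem_univ j)
    have hv' : ∑ j, ‖v j‖ ^ 2 < 1 := hv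
    nlinarith [norm_nonneg (v j)]
  let r : ℝ := √(Q⁻¹)
  have hr0 : 0 ≤ r := Real.sqrt_nonneg _
  have hr2 : r ^ 2 = Q⁻¹ := Real.sq_sqrt (by positivity)
  have hrpos : 0 < r := Real.sqrt_pos.2 (by positivity)
  have hsub : r • E ⊆ B '' E := by
    rintro _ ⟨w, hw, rfl⟩
    obtain ⟨v, hv⟩ := hsurj (r • w)
    refine ⟨v, ?_, hv⟩
    have h := hB v
    rw [hv] at h
    have h3 : ∑ j, ‖(r • w) j‖ ^ 2 = Q⁻¹ * ∑ j, ‖w j‖ ^ 2 := by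
      rw [Finset.mul_sum]
      refine Finset.sum_congr rfl fun j _ => ?_
      rw [Pi.smul_apply, norm_smul, mul_pow, Real.norm_eq_abs, sq_abs, hr2]
    rw [h3, div_eq_inv_mul] at h
    exact (le_of_mul_le_mul_left h (by positivity)).trans_lt hw
  have hle := measure_mono (μ := volume) hsub
  rw [Measure.addHaar_smul_of_nonneg _ hr0, Measure.addHaar_image_linearMap] at hle
  have := (ENNReal.mul_le_mul_iff_left hE0 hEt).1 hle
  rw [ENNReal.ofReal_le_ofReal_iff (abs_nonneg _)] at this
  have hfr : Module.finrank ℝ (Cn m) = 2 * m := by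
    rw [Module.finrank_pi_fintype]; simp [Complex.finrank_real_complex, mul_comm]
  rw [hfr, pow_mul, hr2, inv_pow] at this
  exact this

/-- The comparison of top forms behind the lower bound for the volume of the end.  Let `a` be a
positive form, `ℓ` a complex linear functional and `η = G ℓ^* (dx ∧ dy)`, and let the real linear map
`T` carry the first coordinate to a multiple of `ℓ` and expand the metric of `γ` on the fibre by
at least `1/Q`.  Then the pull-back by `T` of `(a + η)^{m+1} - a^{m+1}`, which is `m + 1` times
`η ∧ a^m`, is bounded below by the product of the pull-back of `η` and `Q^{-m} γ^m`. -/
theorem wedgePow_fibre_comparison {m : ℕ} {a η : Cn (m + 1) [⋀^Fin 2]→L[ℝ] ℝ}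
    (ha : IsPositiveForm a) {ℓ : Cn (m + 1) →ₗ[ℂ] ℂ} {G : ℝ} (hG : 0 ≤ G)
    (hη : ∀ v w, η ![v, w] = G * areaForm ![ℓ v, ℓ w])
    (T : Cn (m + 1) →ₗ[ℝ] Cn (m + 1)) {c : ℂ} (hT : ∀ v, ℓ (T v) = c * v 0)
    {γ : Cn m [⋀^Fin 2]→L[ℝ] ℝ} (hγ : IsPositiveForm γ) {Q : ℝ} (hQ : 0 < Q)
    (hQT : ∀ v : Cn m, γ ![v, Complex.I • v] / Q
      ≤ a ![T (Fin.cons 0 v), Complex.I • T (Fin.cons 0 v)]) :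
    G * ‖c‖ ^ 2 * ((m + 1) / Q ^ m) * twoFormWedgePow γ (stdFrame m)
      ≤ (twoFormWedgePow (a + η) (stdFrame (m + 1)) - twoFormWedgePow a (stdFrame (m + 1)))
        * |LinearMap.det T| := by
  obtain ⟨L, r, hr, hL, hℓ⟩ := ha.exists_unitary ℓ
  obtain ⟨M, hM⟩ := hγ.exists_unitary'
  rw [twoFormWedgePow_add_pullback hη hL hℓ]
  have hLd := twoFormWedgePow_of_diag_comp L 1 (by simpa using hL)
  have hMd := twoFormWedgePow_of_diag_comp M 1 (by simpa using hM)
  simp only [Pi.one_apply, Finset.prod_const_one, mul_one] at hLd hMd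
  have hLpos := det_realCLM_pos L
  have hMpos := det_realCLM_pos M
  set DL := LinearMap.det ((L : Cn (m + 1) →ₗ[ℂ] Cn (m + 1)).restrictScalars ℝ) with hDL
  set DM := LinearMap.det ((M : Cn m →ₗ[ℂ] Cn m).restrictScalars ℝ) with hDM
  set A := twoFormWedgePow a (stdFrame (m + 1))
  set Γ := twoFormWedgePow γ (stdFrame m)
  have hApos : 0 < A := ha.wedgePow_pos
  have hΓpos : 0 < Γ := hγ.wedgePow_pos
  have hself : ∀ (k : ℕ) (v : Cn k), ∑ j, areaForm ![v j, (Complex.I • v) j] = ∑ j, ‖v j‖ ^ 2 := by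
    intro k v
    exact Finset.sum_congr rfl fun j _ => areaForm_self_I (v j)
  -- `N` is `T` seen in the unitary frame of `a`
  let N : Cn (m + 1) →ₗ[ℝ] Cn (m + 1) :=
    (L.symm : Cn (m + 1) →ₗ[ℂ] Cn (m + 1)).restrictScalars ℝ ∘ₗ T
  have hTN : T = (L : Cn (m + 1) →ₗ[ℂ] Cn (m + 1)).restrictScalars ℝ ∘ₗ N := by
    exact LinearMap.ext fun v => by simp [N]
  have hdetT : LinearMap.det T = DL * LinearMap.det N := by
    conv_lhs => rw [hTN]
    rw [LinearMap.det_comp]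
  have hrN : ∀ v, (r : ℂ) * N v 0 = c * v 0 := by
    intro v
    rw [← hℓ, ← hT]
    simp [N]
  have hrhs : ((1 + G * r ^ 2) * A - A) * |LinearMap.det T|
      = G * (m + 1).factorial * (r ^ 2 * |LinearMap.det N|) := by
    rw [hdetT, abs_mul, abs_of_pos hLpos, ← hLd]; ring
  have hΓ : ((m + 1 : ℕ).factorial : ℝ) = (m + 1) * (DM * Γ) := by
    rw [hMd, Nat.factorial_succ]; push_cast; ring
  have key : ‖c‖ ^ 2 * (Q ^ m)⁻¹ ≤ r ^ 2 * |LinearMap.det N| * DM := by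
    rcases eq_or_ne r 0 with h0 | h0
    · have : c = 0 := by
        have := hrN (Pi.single 0 1)
        simpa [h0] using this.symm
      simp [this, h0]
    have hr0 : (r : ℂ) ≠ 0 := by exact_mod_cast h0
    have hN0 : ∀ v, N v 0 = c / r * v 0 := by
      intro v
      rw [div_mul_eq_mul_div, ← hrN, mul_div_cancel_left₀ _ hr0]
    let B : Cn m →ₗ[ℝ] Cn m := LinearMap.funLeft ℝ ℂ Fin.succ ∘ₗ N ∘ₗ
      (Fin.consLinearEquiv ℝ (fun _ : Fin (m + 1) => ℂ)).toLinearMap ∘ₗ LinearMap.inr ℝ ℂ (Cn m)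
    have hB : ∀ v, N (Fin.cons 0 v) = Fin.cons 0 (B v) := by
      intro v
      funext j
      refine Fin.cases ?_ (fun i => ?_) j
      · rw [hN0]; simp
      · rfl
    have hdetN := det_eq_of_fibred N (c / r) hN0 B hB
    have hBM := inv_pow_le_abs_det (B ∘ₗ (M : Cn m →ₗ[ℂ] Cn m).restrictScalars ℝ) hQ (by
      intro v
      have h1 := hQT (M v)
      rw [← map_smul, hM, hself] at h1
      have h2 : T (Fin.cons 0 (M v)) = L (Fin.cons 0 (B (M v))) := by
        rw [← hB]; simp [N]
      rw [h2, ← map_smul, hL, hself, Fin.sum_univ_succ] at h1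
      simpa using h1)
    rw [LinearMap.det_comp, abs_mul, abs_of_pos hMpos] at hBM
    rw [hdetN, abs_mul, abs_of_nonneg (by positivity), norm_div, Complex.norm_real, div_pow,
      Real.norm_eq_abs, sq_abs]
    have : r ^ 2 * (‖c‖ ^ 2 / r ^ 2 * |LinearMap.det B|) * DM
        = ‖c‖ ^ 2 * (|LinearMap.det B| * DM) := by
      field_simp
    rw [this]
    exact mul_le_mul_of_nonneg_left hBM (by positivity)
  rw [hrhs, hΓ]
  calc G * ‖c‖ ^ 2 * ((m + 1) / Q ^ m) * Γ = G * (m + 1) * Γ * (‖c‖ ^ 2 * (Q ^ m)⁻¹) := by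
        rw [div_eq_mul_inv]; ring
    _ ≤ G * (m + 1) * Γ * (r ^ 2 * |LinearMap.det N| * DM) :=
        mul_le_mul_of_nonneg_left key (by positivity)
    _ = _ := by ring

/-! ### Complex manifolds as real manifolds -/

theorem HasMFDerivAt.restrictScalars_real {E E' M M' : Type*} [NormedAddCommGroup E]
    [NormedSpace ℂ E] [NormedAddCommGroup E'] [NormedSpace ℂ E'] [TopologicalSpace M]
    [ChartedSpace E M] [TopologicalSpace M'] [ChartedSpace E' M'] {f : M → M'} {x : M}
    {f' : TangentSpace 𝓘(ℂ, E) x →L[ℂ] TangentSpace 𝓘(ℂ, E') (f x)}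
    (h : HasMFDerivAt 𝓘(ℂ, E) 𝓘(ℂ, E') f x f') :
    HasMFDerivAt 𝓘(ℝ, E) 𝓘(ℝ, E') f x
      ((show E →L[ℂ] E' from f').restrictScalars ℝ : E →L[ℝ] E') := by
  refine ⟨h.1, ?_⟩
  have := h.2
  exact HasFDerivWithinAt.restrictScalars (F := E') ℝ this

section
variable {d : ℕ} {X : Type*} [TopologicalSpace X] [ChartedSpace (Cn d) X]

theorem isManifold_real [IsManifold 𝓘(ℂ, Cn d) (⊤ : WithTop ℕ∞) X] :
    IsManifold 𝓘(ℝ, Cn d) (⊤ : ℕ∞) X := by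
  refine isManifold_of_contDiffOn _ _ _ fun e e' he he' => ?_
  have h := contDiffGroupoid_le (I := 𝓘(ℂ, Cn d)) (m := (⊤ : ℕ∞)) le_top
    (HasGroupoid.compatible (G := contDiffGroupoid (⊤ : WithTop ℕ∞) 𝓘(ℂ, Cn d)) he he')
  exact ContDiffOn.restrict_scalars ℝ (mem_groupoid_of_pregroupoid.1 h).1

/-- The coordinate frame of a chart is complex linear, since the charts are holomorphic. -/
theorem exists_chartFrame_eq [IsManifold 𝓘(ℂ, Cn d) (⊤ : WithTop ℕ∞) X]
    (c : X) {y : Cn d} (hy : y ∈ (chartAt (Cn d) c).target) :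
    ∃ L : Cn d ≃ₗ[ℂ] Cn d, chartFrame c y = realCLM (L : Cn d →ₗ[ℂ] Cn d) := by
  have : IsManifold 𝓘(ℂ, Cn d) 1 X := IsManifold.of_le (n := (⊤ : WithTop ℕ∞)) le_top
  have h := (mdifferentiable_chart (I := 𝓘(ℂ, Cn d)) c)
  have hd := (h.symm.mdifferentiableAt hy).hasMFDerivAt
  let L := (h.symm.mfderiv hy)
  refine ⟨L.toLinearEquiv, ?_⟩
  have := hd.restrictScalars_real.mfderiv
  rw [chartFrame, this]
  rfl

theorem chartFrame_I_smul [IsManifold 𝓘(ℂ, Cn d) (⊤ : WithTop ℕ∞) X]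
    (c : X) {y : Cn d} (hy : y ∈ (chartAt (Cn d) c).target) (v : Cn d) :
    chartFrame c y (Complex.I • v) = Complex.I • chartFrame c y v := by
  obtain ⟨L, hL⟩ := exists_chartFrame_eq c hy
  rw [hL]
  exact map_smul L Complex.I v

theorem chartFrame_ne_zero [IsManifold 𝓘(ℂ, Cn d) (⊤ : WithTop ℕ∞) X]
    (c : X) {y : Cn d} (hy : y ∈ (chartAt (Cn d) c).target) {v : Cn d}
    (hv : v ≠ 0) : chartFrame c y v ≠ 0 := by
  obtain ⟨L, hL⟩ := exists_chartFrame_eq c hy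
  rw [hL]
  exact (map_ne_zero_iff L L.injective).2 hv

theorem det_chartFrame_pos [IsManifold 𝓘(ℂ, Cn d) (⊤ : WithTop ℕ∞) X]
    (c : X) {y : Cn d} (hy : y ∈ (chartAt (Cn d) c).target) :
    0 < (chartFrame c y).det := by
  obtain ⟨L, hL⟩ := exists_chartFrame_eq c hy
  rw [hL]
  exact det_realCLM_pos L

theorem IsKahlerForm.isPositiveForm_localForm [IsManifold 𝓘(ℂ, Cn d) (⊤ : WithTop ℕ∞) X]
    {ω : TwoForm d X} (h : IsKahlerForm ω) (c : X)
    {y : Cn d} (hy : y ∈ (chartAt (Cn d) c).target) : IsPositiveForm (localForm ω c y) := by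
  have key : ∀ v w, localForm ω c y ![v, w]
      = ω ((chartAt (Cn d) c).symm y) ![chartFrame c y v, chartFrame c y w] := by
    intro v w
    simp only [localForm, ContinuousAlternatingMap.compContinuousLinearMap_apply]
    congr 1; ext k; fin_cases k <;> rfl
  constructor
  · intro v w
    rw [key, key, chartFrame_I_smul c hy, chartFrame_I_smul c hy, h.invariant]
  · intro v hv
    rw [key, chartFrame_I_smul c hy]
    exact h.positive _ _ (chartFrame_ne_zero c hy hv)

theorem localDensity_eq_det_mul (τ : TopForm d X) (c : X) (y : Cn d) :
    localDensity τ c y = (chartFrame c y).det * τ ((chartAt (Cn d) c).symm y) (stdFrame d) :=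
  topForm_comp_stdFrame _ (chartFrame c y : Cn d →ₗ[ℝ] Cn d)

theorem localDensity_topPow (ω : TwoForm d X) (c : X) (y : Cn d) :
    localDensity (topPow ω) c y = twoFormWedgePow (localForm ω c y) (stdFrame d) :=
  (twoFormWedgePow_comp _ _ _).symm

theorem localDensity_topPow_pos [IsManifold 𝓘(ℂ, Cn d) (⊤ : WithTop ℕ∞) X]
    {ω : TwoForm d X} (h : IsKahlerForm ω) (c : X)
    {y : Cn d} (hy : y ∈ (chartAt (Cn d) c).target) : 0 < localDensity (topPow ω) c y := by
  rw [localDensity_topPow]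
  exact (h.isPositiveForm_localForm c hy).wedgePow_pos

theorem localDensity_eq_formRatio_mul (τ : TopForm d X) {κ : TopForm d X} (c : X) (y : Cn d)
    (hκ : κ ((chartAt (Cn d) c).symm y) (stdFrame d) ≠ 0) :
    localDensity τ c y = formRatio τ κ ((chartAt (Cn d) c).symm y) * localDensity κ c y := by
  rw [localDensity_eq_det_mul, localDensity_eq_det_mul, formRatio]
  field_simp

theorem continuousOn_localDensity_topPow {ω : TwoForm d X}
    (h : ∀ c : X, ContDiffOn ℝ (⊤ : ℕ∞) (localForm ω c) (chartAt (Cn d) c).target) (c : X) :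
    ContinuousOn (localDensity (topPow ω) c) (chartAt (Cn d) c).target := by
  simp only [funext (localDensity_topPow ω c), twoFormWedgePow_apply]
  refine continuousOn_const.mul (continuousOn_finsetSum _ fun π _ => continuousOn_const.mul
    (continuousOn_finsetProd _ fun j _ => ?_))
  exact (continuous_eval_const (F := Cn d [⋀^Fin 2]→L[ℝ] ℝ) _).comp_continuousOn
    (h c).continuousOn

theorem IsKahlerForm.topPow_pos {ω : TwoForm d X} (h : IsKahlerForm ω) (x : X) :
    0 < topPow ω x (stdFrame d) := (h.isPositiveForm x).wedgePow_pos

/-- A quotient of top powers is continuous although the values of the forms on the standard frame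
need not be: the preferred chart jumps from point to point, and the jumps cancel in the quotient. -/
theorem continuous_formRatio [IsManifold 𝓘(ℂ, Cn d) (⊤ : WithTop ℕ∞) X]
    {ω ω' : TwoForm d X} (h : IsKahlerForm ω)
    (h' : ∀ c : X, ContDiffOn ℝ (⊤ : ℕ∞) (localForm ω' c) (chartAt (Cn d) c).target) :
    Continuous (formRatio (topPow ω') (topPow ω)) := by
  rw [continuous_iff_continuousAt]
  intro x
  let e := chartAt (Cn d) x
  have hx : e x ∈ e.target := mem_chart_target _ x
  have hc : ContinuousAt (fun y => localDensity (topPow ω') x y / localDensity (topPow ω) x y)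
      (e x) :=
    ((continuousOn_localDensity_topPow h' x).continuousAt (e.open_target.mem_nhds hx)).div
      ((continuousOn_localDensity_topPow h.smooth x).continuousAt (e.open_target.mem_nhds hx))
      (localDensity_topPow_pos h x hx).ne'
  refine (hc.comp (e.continuousAt (mem_chart_source _ x))).congr ?_
  filter_upwards [e.open_source.mem_nhds (mem_chart_source _ x)] with z hz
  have h1 := localDensity_eq_formRatio_mul (topPow ω') (κ := topPow ω) x (e z)
    (h.topPow_pos _).ne'
  have h2 := (localDensity_topPow_pos h x (e.map_source hz)).ne'
  simp only [Function.comp]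
  rw [h1, mul_div_cancel_right₀ _ h2]
  exact congrArg _ (e.left_inv hz)

end

/-! ### Integration of top forms -/

theorem ContinuousOn.measurableSet_inter_preimage {α β : Type*} [TopologicalSpace α]
    [MeasurableSpace α] [OpensMeasurableSpace α] [TopologicalSpace β] [MeasurableSpace β]
    [BorelSpace β] {f : α → β} {s : Set α} (hf : ContinuousOn f s) (hs : MeasurableSet s)
    {t : Set β} (ht : MeasurableSet t) : MeasurableSet (s ∩ f ⁻¹' t) := by
  have := hs.subtype_image (hf.domRestrict.measurable ht)
  convert this using 1
  ext y
  simp [and_comm]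

section
variable {d : ℕ} {X : Type*} [TopologicalSpace X] [ChartedSpace (Cn d) X]
  [SecondCountableTopology X] [Nonempty X]

/-- The part of `X` parametrized by `chartPiece d X k`. -/
def manifoldPiece (d : ℕ) (X : Type*) [TopologicalSpace X] [ChartedSpace (Cn d) X]
    [SecondCountableTopology X] [Nonempty X] (k : ℕ) : Set X :=
  disjointed (fun k => (chartAt (Cn d) (chartSeq d X k)).source) k

theorem manifoldPiece_subset (k : ℕ) :
    manifoldPiece d X k ⊆ (chartAt (Cn d) (chartSeq d X k)).source := disjointed_subset _ _

theorem iUnion_manifoldPiece : ⋃ k, manifoldPiece d X k = univ := by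
  unfold manifoldPiece
  rw [iUnion_disjointed]
  exact (exists_chartSeq d X).choose_spec

theorem disjoint_manifoldPiece : Pairwise (Function.onFun Disjoint (manifoldPiece d X)) :=
  disjoint_disjointed _

variable [MeasurableSpace X] [BorelSpace X]

theorem measurableSet_manifoldPiece (k : ℕ) : MeasurableSet (manifoldPiece d X k) :=
  MeasurableSet.disjointed (fun k => (chartAt (Cn d) (chartSeq d X k)).open_source.measurableSet) k

theorem measurableSet_chartPiece (k : ℕ) : MeasurableSet (chartPiece d X k) :=
  (chartAt (Cn d) (chartSeq d X k)).continuousOn_symm.measurableSet_inter_preimage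
    (chartAt (Cn d) (chartSeq d X k)).open_target.measurableSet (measurableSet_manifoldPiece k)

theorem aemeasurable_localDensity {τ : TopForm d X}
    (hτ : ∀ c, ContinuousOn (localDensity τ c) (chartAt (Cn d) c).target) (k : ℕ) :
    AEMeasurable (fun y => ENNReal.ofReal (localDensity τ (chartSeq d X k) y))
      (volume.restrict (chartPiece d X k)) :=
  (((hτ (chartSeq d X k)).mono inter_subset_left).aemeasurable
    (measurableSet_chartPiece k)).ennreal_ofReal

theorem aemeasurable_chart_symm (k : ℕ) :
    AEMeasurable (chartAt (Cn d) (chartSeq d X k)).symm (volume.restrict (chartPiece d X k)) :=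
  ((chartAt (Cn d) (chartSeq d X k)).continuousOn_symm.mono inter_subset_left).aemeasurable
    (measurableSet_chartPiece k)

theorem lintegral_formMeasure {τ : TopForm d X}
    (hτ : ∀ c, ContinuousOn (localDensity τ c) (chartAt (Cn d) c).target)
    {g : X → ENNReal} (hg : AEMeasurable g (formMeasure τ)) :
    ∫⁻ x, g x ∂formMeasure τ = ∑' k, ∫⁻ y in chartPiece d X k,
      ENNReal.ofReal (localDensity τ (chartSeq d X k) y)
        * g ((chartAt (Cn d) (chartSeq d X k)).symm y) := by
  rw [formMeasure, lintegral_sum_measure]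
  congr 1; funext k
  have h1 : AEMeasurable (chartAt (Cn d) (chartSeq d X k)).symm
      ((volume.restrict (chartPiece d X k)).withDensity fun y =>
        ENNReal.ofReal (localDensity τ (chartSeq d X k) y)) :=
    (aemeasurable_chart_symm k).mono' (withDensity_absolutelyContinuous _ _)
  have h2 := hg.mono_measure (Measure.le_sum _ k)
  rw [lintegral_map' h2 h1]
  exact lintegral_withDensity_eq_lintegral_mul₀'
    (aemeasurable_localDensity hτ k) (h2.comp_aemeasurable h1)

theorem formMeasure_univ (τ : TopForm d X) :
    formMeasure τ univ = ∑' k, ∫⁻ y in chartPiece d X k,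
      ENNReal.ofReal (localDensity τ (chartSeq d X k) y) := by
  rw [formMeasure, Measure.sum_apply _ MeasurableSet.univ]
  congr 1; funext k
  have h1 : AEMeasurable (chartAt (Cn d) (chartSeq d X k)).symm
      ((volume.restrict (chartPiece d X k)).withDensity fun y =>
        ENNReal.ofReal (localDensity τ (chartSeq d X k) y)) :=
    (aemeasurable_chart_symm k).mono' (withDensity_absolutelyContinuous _ _)
  rw [Measure.map_apply_of_aemeasurable h1 MeasurableSet.univ, preimage_univ,
    withDensity_apply _ MeasurableSet.univ, Measure.restrict_univ]

/-- The total mass of the positive part of a top form, in terms of its quotient by `ω^d`. -/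
theorem formMeasure_univ_eq_lintegral [IsManifold 𝓘(ℂ, Cn d) (⊤ : WithTop ℕ∞) X]
    {ω : TwoForm d X} (hω : IsKahlerForm ω) (τ : TopForm d X)
    (hm : AEMeasurable (formRatio τ (topPow ω)) (formMeasure (topPow ω))) :
    formMeasure τ univ
      = ∫⁻ x, ENNReal.ofReal (formRatio τ (topPow ω) x) ∂formMeasure (topPow ω) := by
  rw [lintegral_formMeasure (continuousOn_localDensity_topPow hω.smooth) hm.ennreal_ofReal,
    formMeasure_univ]
  congr 1; funext k
  refine setLIntegral_congr_fun (measurableSet_chartPiece k) fun y hy => ?_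
  rw [← ENNReal.ofReal_mul (localDensity_topPow_pos hω _ hy.1).le, mul_comm,
    ← localDensity_eq_formRatio_mul τ _ y (hω.topPow_pos _).ne']

/-- Integrability and the integral of a top form, in terms of its quotient by `ω^d`. -/
theorem formIntegral_eq_integral [IsManifold 𝓘(ℂ, Cn d) (⊤ : WithTop ℕ∞) X]
    {ω : TwoForm d X} (hω : IsKahlerForm ω) (τ : TopForm d X)
    (hi : Integrable (formRatio τ (topPow ω)) (formMeasure (topPow ω))) :
    FormIntegrable τ ∧
      formIntegral τ = ∫ x, formRatio τ (topPow ω) x ∂formMeasure (topPow ω) := by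
  have hneg : formRatio (-τ) (topPow ω) = fun x => -formRatio τ (topPow ω) x := by
    funext x
    simp [formRatio, neg_div]
  have h1 := formMeasure_univ_eq_lintegral hω τ hi.aemeasurable
  have h2 := formMeasure_univ_eq_lintegral hω (-τ) (by rw [hneg]; exact hi.aemeasurable.neg)
  rw [hneg] at h2
  refine ⟨⟨?_, ?_⟩, ?_⟩
  · rw [h1]; exact hi.lintegral_lt_top
  · rw [h2]; exact hi.neg.lintegral_lt_top
  · rw [formIntegral, h1, h2, integral_eq_lintegral_pos_part_sub_lintegral_neg_part hi]

/-- The Jacobian determinant of a map `ℂ^d → X`, where the tangent spaces of `X` are identified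
with `ℂ^d` through the preferred charts. -/
def frameDet {d : ℕ} {X : Type*} [TopologicalSpace X] [ChartedSpace (Cn d) X] (f : Cn d → X)
    (y : Cn d) : ℝ :=
  ContinuousLinearMap.det (M := Cn d) (R := ℝ) (mfderiv 𝓘(ℝ, Cn d) 𝓘(ℝ, Cn d) f y)

/-- Change of variables for the measure of a nonnegative top form under an injective
parametrization. -/
theorem setLIntegral_image_formMeasure [IsManifold 𝓘(ℂ, Cn d) (⊤ : WithTop ℕ∞) X]
    {τ : TopForm d X}
    (hτ : ∀ c, ContinuousOn (localDensity τ c) (chartAt (Cn d) c).target)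
    {g : X → ENNReal} (hg : Measurable g) {f : Cn d → X} {s : Set (Cn d)} (hs : MeasurableSet s)
    (hinj : InjOn f s) (hf : ∀ y ∈ s, MDifferentiableAt 𝓘(ℝ, Cn d) 𝓘(ℝ, Cn d) f y) :
    MeasurableSet (f '' s) ∧ ∫⁻ x in f '' s, g x ∂formMeasure τ = ∫⁻ y in s, ENNReal.ofReal
      (τ (f y) (stdFrame d) * |frameDet f y|)
        * g (f y) := by
  have : IsManifold 𝓘(ℝ, Cn d) (⊤ : ℕ∞) X := isManifold_real
  have : IsManifold 𝓘(ℝ, Cn d) 1 X := IsManifold.of_le (n := (⊤ : ℕ∞)) (by exact_mod_cast le_top)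
  have hfc : ContinuousOn f s := fun y hy => (hf y hy).continuousAt.continuousWithinAt
  let e := fun k => chartAt (Cn d) (chartSeq d X k)
  -- the parts of `s` that `f` maps into the pieces of `X`, and `f` in the charts of the pieces
  let sk := fun k => s ∩ f ⁻¹' manifoldPiece d X k
  let F := fun k => e k ∘ f
  have hsk : ∀ k, MeasurableSet (sk k) := fun k =>
    hfc.measurableSet_inter_preimage hs (measurableSet_manifoldPiece k)
  have hske : ∀ k, ∀ y ∈ sk k, f y ∈ (e k).source := fun k y hy => manifoldPiece_subset k hy.2
  have hunion : s = ⋃ k, sk k := by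
    rw [← inter_iUnion, ← preimage_iUnion, iUnion_manifoldPiece, preimage_univ, inter_univ]
  have hdisj : Pairwise (Function.onFun Disjoint sk) := fun i j hij =>
    ((disjoint_manifoldPiece hij).preimage f).mono inter_subset_right inter_subset_right
  have hFd : ∀ k, ∀ y ∈ sk k, MDifferentiableAt 𝓘(ℝ, Cn d) 𝓘(ℝ, Cn d) (F k) y := fun k y hy =>
    ((mdifferentiable_chart _).mdifferentiableAt (hske k y hy)).comp y (hf y hy.1)
  have hF' : ∀ k, ∀ y ∈ sk k, HasFDerivWithinAt (F k) (fderiv ℝ (F k) y) (sk k) y := fun k y hy =>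
    (mdifferentiableAt_iff_differentiableAt.1 (hFd k y hy)).hasFDerivAt.hasFDerivWithinAt
  have hFinj : ∀ k, InjOn (F k) (sk k) := fun k =>
    (e k).injOn.comp (hinj.mono inter_subset_left) (fun y hy => hske k y hy)
  have hFm : ∀ k, MeasurableSet (F k '' sk k) := fun k =>
    measurable_image_of_fderivWithin (hsk k) (hF' k) (hFinj k)
  have hchain : ∀ k, ∀ y ∈ sk k, (mfderiv 𝓘(ℝ, Cn d) 𝓘(ℝ, Cn d) f y : Cn d →L[ℝ] Cn d)
      = (chartFrame (chartSeq d X k) (F k y)).comp (fderiv ℝ (F k) y) := by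
    intro k y hy
    have hev : f =ᶠ[𝓝 y] (e k).symm ∘ F k := by
      filter_upwards [(hf y hy.1).continuousAt.preimage_mem_nhds
        ((e k).open_source.mem_nhds (hske k y hy))] with z hz
      exact ((e k).left_inv hz).symm
    rw [hev.mfderiv_eq, mfderiv_comp y _ (hFd k y hy), mfderiv_eq_fderiv]
    · rfl
    · exact ((mdifferentiable_chart _).symm.mdifferentiableAt ((e k).map_source (hske k y hy)))
  have himage : ∀ k, (f '' s) ∩ manifoldPiece d X k = (e k).source ∩ e k ⁻¹' (F k '' sk k) := by
    intro k
    ext x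
    constructor
    · rintro ⟨⟨y, hy, rfl⟩, hx⟩
      exact ⟨manifoldPiece_subset k hx, y, ⟨hy, hx⟩, rfl⟩
    · rintro ⟨hx, y, hy, hyx⟩
      have := (e k).injOn (hske k y hy) hx hyx
      exact this ▸ ⟨mem_image_of_mem f hy.1, hy.2⟩
  have himage' : ∀ k, chartPiece d X k ∩ (e k).symm ⁻¹' (f '' s) = F k '' sk k := by
    intro k
    ext w
    constructor
    · rintro ⟨⟨hw, hw1⟩, y, hy, hyw⟩
      have h1 : f y ∈ manifoldPiece d X k := by rw [hyw]; exact hw1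
      refine ⟨y, ⟨hy, h1⟩, ?_⟩
      simp only [F, Function.comp, hyw]
      exact (e k).right_inv hw
    · rintro ⟨y, hy, rfl⟩
      have h1 : (e k).symm (F k y) = f y := (e k).left_inv (hske k y hy)
      refine ⟨⟨(e k).map_source (hske k y hy), ?_⟩, ?_⟩
      · change (e k).symm (F k y) ∈ manifoldPiece d X k
        rw [h1]; exact hy.2
      · rw [mem_preimage, h1]; exact mem_image_of_mem f hy.1
  have hfs : MeasurableSet (f '' s) := by
    have : f '' s = ⋃ k, (e k).source ∩ e k ⁻¹' (F k '' sk k) := by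
      rw [← iUnion_congr himage, ← inter_iUnion, iUnion_manifoldPiece, inter_univ]
    rw [this]
    exact MeasurableSet.iUnion fun k =>
      (e k).continuousOn.measurableSet_inter_preimage (e k).open_source.measurableSet (hFm k)
  refine ⟨hfs, ?_⟩
  rw [← lintegral_indicator hfs, lintegral_formMeasure hτ (hg.indicator hfs).aemeasurable]
  conv_rhs => rw [hunion, lintegral_iUnion hsk hdisj]
  congr 1; funext k
  have h1 : ∀ y, ENNReal.ofReal (localDensity τ (chartSeq d X k) y)
        * (f '' s).indicator g ((e k).symm y) = ((e k).symm ⁻¹' (f '' s)).indicator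
          (fun y => ENNReal.ofReal (localDensity τ (chartSeq d X k) y) * g ((e k).symm y)) y := by
    intro y
    by_cases hy : (e k).symm y ∈ f '' s
    · rw [indicator_of_mem hy, indicator_of_mem (by exact hy)]
    · rw [indicator_of_notMem hy, indicator_of_notMem (by exact hy), mul_zero]
  have h2 : ∫⁻ y in chartPiece d X k, ENNReal.ofReal (localDensity τ (chartSeq d X k) y)
        * (f '' s).indicator g ((e k).symm y)
      = ∫⁻ y in F k '' sk k,
        ENNReal.ofReal (localDensity τ (chartSeq d X k) y) * g ((e k).symm y) := by
    rw [← himage', lintegral_congr h1, ← lintegral_indicator (measurableSet_chartPiece k),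
      indicator_indicator, lintegral_indicator]
    rw [himage']; exact hFm k
  refine h2.trans ?_
  rw [lintegral_image_eq_lintegral_abs_det_fderiv_mul volume (hsk k) (hF' k) (hFinj k)]
  refine setLIntegral_congr_fun (hsk k) fun y hy => ?_
  have h3 : (e k).symm (F k y) = f y := (e k).left_inv (hske k y hy)
  have hpos : 0 < (chartFrame (chartSeq d X k) (F k y)).det :=
    det_chartFrame_pos (chartSeq d X k) ((e k).map_source (hske k y hy))
  have hdc : frameDet f y = (chartFrame (chartSeq d X k) (F k y)).det * (fderiv ℝ (F k) y).det :=
    (congrArg (ContinuousLinearMap.det (M := Cn d) (R := ℝ)) (hchain k y hy)).trans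
      (LinearMap.det_comp _ _)
  rw [hdc, localDensity_eq_det_mul, h3, ← mul_assoc, ← ENNReal.ofReal_mul (abs_nonneg _), abs_mul,
    abs_of_pos hpos]
  congr 2
  change _ = _ * ((chartFrame (chartSeq d X k) (F k y)).det * |(fderiv ℝ (F k) y).det|)
  ring

theorem measure_chart_symm_image [IsManifold 𝓘(ℂ, Cn d) (⊤ : WithTop ℕ∞) X]
    {τ : TopForm d X}
    (hτ : ∀ c, ContinuousOn (localDensity τ c) (chartAt (Cn d) c).target) (c : X)
    {s : Set (Cn d)} (hs : MeasurableSet s) (hst : s ⊆ (chartAt (Cn d) c).target) :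
    formMeasure τ ((chartAt (Cn d) c).symm '' s)
      = ∫⁻ y in s, ENNReal.ofReal (localDensity τ c y) := by
  have : IsManifold 𝓘(ℝ, Cn d) (⊤ : ℕ∞) X := isManifold_real
  have : IsManifold 𝓘(ℝ, Cn d) 1 X := IsManifold.of_le (n := (⊤ : ℕ∞)) (by exact_mod_cast le_top)
  have h := (setLIntegral_image_formMeasure hτ (g := fun _ => 1) measurable_const hs
    ((chartAt (Cn d) c).symm.injOn.mono hst) (fun y hy =>
      (mdifferentiable_chart c).symm.mdifferentiableAt (hst hy))).2
  simp only [lintegral_const, Measure.restrict_apply_univ, one_mul, mul_one] at h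
  rw [h]
  refine setLIntegral_congr_fun hs fun y hy => ?_
  have hpos : 0 < frameDet (chartAt (Cn d) c).symm y := det_chartFrame_pos c (hst hy)
  rw [localDensity_eq_det_mul, abs_of_pos hpos, mul_comm]
  rfl

/-- The measure of a Kähler manifold is finite on compact sets, although the density may be unbounded
near the boundary of the pieces used in its definition: it can be computed in any chart. -/
theorem isLocallyFiniteMeasure_formMeasure [IsManifold 𝓘(ℂ, Cn d) (⊤ : WithTop ℕ∞) X]
    {ω : TwoForm d X} (hω : IsKahlerForm ω) :
    IsLocallyFiniteMeasure (formMeasure (topPow ω)) := by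
  refine ⟨fun x => ?_⟩
  let e := chartAt (Cn d) x
  have hx : e x ∈ e.target := mem_chart_target _ x
  obtain ⟨r, hr, hrs⟩ := Metric.nhds_basis_closedBall.mem_iff.1 (e.open_target.mem_nhds hx)
  have hc := continuousOn_localDensity_topPow hω.smooth
  refine ⟨e.symm '' Metric.closedBall (e x) r, ?_, ?_⟩
  · have h := e.symm.image_mem_nhds (x := e x) hx (Metric.closedBall_mem_nhds (e x) hr)
    rwa [e.left_inv (mem_chart_source _ x)] at h
  · rw [measure_chart_symm_image hc x Metric.isClosed_closedBall.measurableSet hrs]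
    have := ((hc x).mono hrs).integrableOn_compact (μ := volume) (isCompact_closedBall _ _)
    exact this.lintegral_lt_top

/-- A nonempty manifold contains a chart domain, which has positive measure. -/
theorem formMeasure_univ_pos [IsManifold 𝓘(ℂ, Cn d) (⊤ : WithTop ℕ∞) X]
    {ω : TwoForm d X} (hω : IsKahlerForm ω) : 0 < formMeasure (topPow ω) univ := by
  obtain ⟨x⟩ := ‹Nonempty X›
  let e := chartAt (Cn d) x
  have hc := continuousOn_localDensity_topPow hω.smooth x
  refine lt_of_lt_of_le ?_ (measure_mono (subset_univ (e.symm '' e.target)))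
  rw [measure_chart_symm_image (continuousOn_localDensity_topPow hω.smooth) x
    e.open_target.measurableSet subset_rfl]
  rw [pos_iff_ne_zero, Ne, lintegral_eq_zero_iff'
    (hc.aemeasurable e.open_target.measurableSet).ennreal_ofReal]
  intro h
  have hF : ∀ᵐ y ∂volume.restrict e.target, False := by
    filter_upwards [h, ae_restrict_mem e.open_target.measurableSet] with y h1 h2
    exact absurd (ENNReal.ofReal_eq_zero.1 h1) (localDensity_topPow_pos hω x h2).not_ge
  rw [eventually_false_iff_eq_bot, ae_eq_bot, Measure.restrict_eq_zero] at hF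
  exact (e.open_target.measure_pos volume ⟨e x, mem_chart_target _ x⟩).ne' hF

/-- The total volume `∫_X ω^d` of a closed Kähler manifold is finite and positive. -/
theorem formIntegral_topPow_compact [IsManifold 𝓘(ℂ, Cn d) (⊤ : WithTop ℕ∞) X] [CompactSpace X]
    {ω : TwoForm d X} (hω : IsKahlerForm ω) :
    0 < formIntegral (topPow ω) ∧
      formMeasure (topPow ω) univ = ENNReal.ofReal (formIntegral (topPow ω)) := by
  have := isLocallyFiniteMeasure_formMeasure hω
  have hfin : formMeasure (topPow ω) univ < ⊤ := isCompact_univ.measure_lt_top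
  have : IsFiniteMeasure (formMeasure (topPow ω)) := ⟨hfin⟩
  have h1 : formRatio (topPow ω) (topPow ω) = fun _ => 1 := by
    funext x
    exact div_self (hω.topPow_pos x).ne'
  have h := (formIntegral_eq_integral hω (topPow ω) (by rw [h1]; exact integrable_const 1)).2
  rw [h1, integral_const, smul_eq_mul, mul_one, Measure.real] at h
  rw [h]
  exact ⟨ENNReal.toReal_pos (formMeasure_univ_pos hω).ne' hfin.ne,
    (ENNReal.ofReal_toReal hfin.ne).symm⟩

end

/-! ### The end of a weak ALG manifold and the projection to `ℂ/⟨σ⟩` -/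

/-- The differential of a complex valued function on a complex manifold, as a real linear map. -/
def realDiff {d : ℕ} {X : Type*} [TopologicalSpace X] [ChartedSpace (Cn d) X] (h : X → ℂ) (x : X) :
    Cn d →L[ℝ] ℂ := mfderiv 𝓘(ℝ, Cn d) 𝓘(ℝ, ℂ) h x

namespace WeakALG

variable {m : ℕ} {X Y : Type*} [TopologicalSpace X] [ChartedSpace (Cn (m + 1)) X]
  [TopologicalSpace Y] [ChartedSpace (Cn m) Y] {β : ℝ} {ω : TwoForm (m + 1) X}

/-- The differential of the parametrization `Φ` of the end. -/
def endDiff (A : WeakALG (Y := Y) β ω) (p : ℂ × Y) : ℂ × Cn m →L[ℝ] Cn (m + 1) :=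
  mfderiv (𝓘(ℝ, ℂ).prod 𝓘(ℝ, Cn m)) 𝓘(ℝ, Cn (m + 1)) A.Φ p

/-- The parametrization of the end by `ℂ × ℂ^m = ℂ^{m+1}` obtained from `Φ` and the chart of `Y`
at `c`. -/
def endChart (A : WeakALG (Y := Y) β ω) (c : Y) (w : Cn (m + 1)) : X :=
  A.Φ (w 0, (chartAt (Cn m) c).symm (Fin.tail w))

/-- A function `h` that represents the holomorphic projection from the end to `ℂ/⟨σ⟩`, in the
coordinate `z ^ n` of `ℂ/⟨σ⟩`. -/
structure IsProjection (A : WeakALG (Y := Y) β ω) (h : X → ℂ) : Prop where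
  holomorphic : MDifferentiableOn 𝓘(ℂ, Cn (m + 1)) 𝓘(ℂ, ℂ) h A.Kᶜ
  comp_Φ : ∀ p ∈ A.K'ᶜ, h (A.Φ p) = p.1 ^ orderOf A.σ

variable (A : WeakALG (Y := Y) β ω)

theorem isOpen_compl_K [T2Space X] : IsOpen A.Kᶜ := A.K_compact.isClosed.isOpen_compl

theorem isOpen_compl_K' [T2Space Y] : IsOpen A.K'ᶜ := A.K'_compact.isClosed.isOpen_compl

theorem Φ_mem {p : ℂ × Y} (hp : p ∈ A.K'ᶜ) : A.Φ p ∈ A.Kᶜ :=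
  A.Φ_image ▸ mem_image_of_mem A.Φ hp

theorem exists_Φ_eq {x : X} (hx : x ∈ A.Kᶜ) : ∃ p ∈ A.K'ᶜ, A.Φ p = x := by
  rwa [← A.Φ_image] at hx

theorem mdifferentiableAt_Φ [T2Space Y] {p : ℂ × Y} (hp : p ∈ A.K'ᶜ) :
    MDifferentiableAt (𝓘(ℝ, ℂ).prod 𝓘(ℝ, Cn m)) 𝓘(ℝ, Cn (m + 1)) A.Φ p :=
  (A.Φ_smooth.contMDiffAt (A.isOpen_compl_K'.mem_nhds hp)).mdifferentiableAt (by simp)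

theorem endDiff_bijective {p : ℂ × Y} (hp : p ∈ A.K'ᶜ) : Function.Bijective (A.endDiff p) :=
  A.Φ_localDiffeo p hp

section EndChart

variable [T2Space Y] [IsManifold 𝓘(ℂ, Cn m) (⊤ : WithTop ℕ∞) Y]

theorem contMDiffAt_endChart (c : Y) {w : Cn (m + 1)}
    (hw : Fin.tail w ∈ (chartAt (Cn m) c).target)
    (hp : (w 0, (chartAt (Cn m) c).symm (Fin.tail w)) ∈ A.K'ᶜ) :
    ContMDiffAt 𝓘(ℝ, Cn (m + 1)) 𝓘(ℝ, Cn (m + 1)) (⊤ : ℕ∞) (A.endChart c) w := by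
  have : IsManifold 𝓘(ℝ, Cn m) (⊤ : ℕ∞) Y := isManifold_real
  have htail : ContMDiffAt 𝓘(ℝ, Cn (m + 1)) 𝓘(ℝ, Cn m) (⊤ : ℕ∞)
      (fun w : Cn (m + 1) => (Fin.tail w : Cn m)) w := by
    rw [contMDiffAt_iff_contDiffAt]
    unfold Fin.tail
    fun_prop
  have h0 : ContMDiffAt 𝓘(ℝ, Cn (m + 1)) 𝓘(ℝ, ℂ) (⊤ : ℕ∞) (fun w : Cn (m + 1) => w 0) w := by
    rw [contMDiffAt_iff_contDiffAt]
    fun_prop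
  have hsymm : ContMDiffAt 𝓘(ℝ, Cn m) 𝓘(ℝ, Cn m) (⊤ : ℕ∞) (chartAt (Cn m) c).symm (Fin.tail w) :=
    contMDiffOn_chart_symm.contMDiffAt ((chartAt (Cn m) c).open_target.mem_nhds hw)
  exact (A.Φ_smooth.contMDiffAt (A.isOpen_compl_K'.mem_nhds hp)).comp w
    (h0.prodMk (hsymm.comp w htail))

theorem mfderiv_endChart (c : Y) {w : Cn (m + 1)}
    (hw : Fin.tail w ∈ (chartAt (Cn m) c).target)
    (hp : (w 0, (chartAt (Cn m) c).symm (Fin.tail w)) ∈ A.K'ᶜ) (v : Cn (m + 1)) :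
    (mfderiv 𝓘(ℝ, Cn (m + 1)) 𝓘(ℝ, Cn (m + 1)) (A.endChart c) w : Cn (m + 1) →L[ℝ] Cn (m + 1)) v
      = A.endDiff (w 0, (chartAt (Cn m) c).symm (Fin.tail w))
        (v 0, chartFrame c (Fin.tail w) (Fin.tail v)) := by
  have : IsManifold 𝓘(ℝ, Cn m) (⊤ : ℕ∞) Y := isManifold_real
  have : IsManifold 𝓘(ℝ, Cn m) 1 Y := IsManifold.of_le (n := (⊤ : ℕ∞)) (by exact_mod_cast le_top)
  let tl : Cn (m + 1) →L[ℝ] Cn m :=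
    ContinuousLinearMap.pi fun j => ContinuousLinearMap.proj (R := ℝ) (φ := fun _ => ℂ) (Fin.succ j)
  let pr : Cn (m + 1) →L[ℝ] ℂ := ContinuousLinearMap.proj (R := ℝ) (φ := fun _ => ℂ) 0
  have htail : HasMFDerivAt 𝓘(ℝ, Cn (m + 1)) 𝓘(ℝ, Cn m) (fun w : Cn (m + 1) => (Fin.tail w : Cn m))
      w tl := tl.hasFDerivAt.hasMFDerivAt
  have h0 : HasMFDerivAt 𝓘(ℝ, Cn (m + 1)) 𝓘(ℝ, ℂ) (fun w : Cn (m + 1) => w 0) w pr :=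
    pr.hasFDerivAt.hasMFDerivAt
  have hsymm := ((mdifferentiable_chart (I := 𝓘(ℝ, Cn m)) c).symm.mdifferentiableAt hw).hasMFDerivAt
  have := (A.mdifferentiableAt_Φ hp).hasMFDerivAt.comp w (h0.prodMk (hsymm.comp w htail))
  rw [show A.endChart c = A.Φ ∘ fun w => (w 0, (chartAt (Cn m) c).symm (Fin.tail w)) from rfl]
  exact congrArg (fun T : Cn (m + 1) →L[ℝ] Cn (m + 1) => T v) this.mfderiv

end EndChart

theorem exists_isProjection : ∃ h, A.IsProjection h :=
  let ⟨h, h1, h2⟩ := A.projection_holomorphic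
  ⟨h, h1, h2⟩

namespace IsProjection

variable {A} {h : X → ℂ}

theorem hasMFDerivAt [T2Space X] (H : A.IsProjection h) {x : X} (hx : x ∈ A.Kᶜ) :
    ∃ ℓ : Cn (m + 1) →L[ℂ] ℂ, HasMFDerivAt 𝓘(ℝ, Cn (m + 1)) 𝓘(ℝ, ℂ) h x (ℓ.restrictScalars ℝ) :=
  ⟨_, ((H.holomorphic x hx).mdifferentiableAt
    (A.isOpen_compl_K.mem_nhds hx)).hasMFDerivAt.restrictScalars_real⟩

theorem mdifferentiableAt [T2Space X] (H : A.IsProjection h) {x : X} (hx : x ∈ A.Kᶜ) :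
    MDifferentiableAt 𝓘(ℝ, Cn (m + 1)) 𝓘(ℝ, ℂ) h x :=
  let ⟨_, hℓ⟩ := H.hasMFDerivAt hx
  hℓ.mdifferentiableAt

/-- The differential of the projection is complex linear. -/
theorem exists_realDiff_eq [T2Space X] (H : A.IsProjection h) {x : X} (hx : x ∈ A.Kᶜ) :
    ∃ ℓ : Cn (m + 1) →ₗ[ℂ] ℂ, ∀ v, realDiff h x v = ℓ v := by
  obtain ⟨ℓ, hℓ⟩ := H.hasMFDerivAt hx
  exact ⟨ℓ, fun v => congrArg (fun T : Cn (m + 1) →L[ℝ] ℂ => T v) hℓ.mfderiv⟩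

theorem realDiff_endDiff [T2Space X] [T2Space Y] (H : A.IsProjection h) {p : ℂ × Y}
    (hp : p ∈ A.K'ᶜ) (q : ℂ × Cn m) :
    realDiff h (A.Φ p) (A.endDiff p q) = (orderOf A.σ : ℂ) * p.1 ^ (orderOf A.σ - 1) * q.1 := by
  have h1 := (H.mdifferentiableAt (A.Φ_mem hp)).hasMFDerivAt.comp p
    (A.mdifferentiableAt_Φ hp).hasMFDerivAt
  have hpow : HasFDerivAt (fun z : ℂ => z ^ orderOf A.σ)
      ((ContinuousLinearMap.toSpanSingleton ℂ
        ((orderOf A.σ : ℂ) * p.1 ^ (orderOf A.σ - 1))).restrictScalars ℝ) p.1 :=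
    (hasDerivAt_pow (orderOf A.σ) p.1).hasFDerivAt.restrictScalars ℝ
  have h2 : HasMFDerivAt (𝓘(ℝ, ℂ).prod 𝓘(ℝ, Cn m)) 𝓘(ℝ, ℂ)
      ((fun z : ℂ => z ^ orderOf A.σ) ∘ (Prod.fst : ℂ × Y → ℂ)) p _ :=
    hpow.hasMFDerivAt.comp p (hasMFDerivAt_fst (x := p))
  have hev : h ∘ A.Φ =ᶠ[𝓝 p] (fun z : ℂ => z ^ orderOf A.σ) ∘ (Prod.fst : ℂ × Y → ℂ) := by
    filter_upwards [A.isOpen_compl_K'.mem_nhds hp] with q hq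
    exact H.comp_Φ q hq
  have h3 := hasMFDerivAt_unique h1 (h2.congr_of_eventuallyEq hev)
  have h4 := congrArg (fun T : ℂ × Cn m →L[ℝ] ℂ => T q) h3
  refine h4.trans ?_
  change ContinuousLinearMap.toSpanSingleton ℂ
    ((orderOf A.σ : ℂ) * p.1 ^ (orderOf A.σ - 1)) q.1 = _
  rw [ContinuousLinearMap.toSpanSingleton_apply, smul_eq_mul, mul_comm]

/-- The projection is smooth: in the coordinates of the end it is `z ^ n`. -/
theorem contMDiffAt [T2Space X] [T2Space Y] [IsManifold 𝓘(ℂ, Cn m) (⊤ : WithTop ℕ∞) Y]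
    [IsManifold 𝓘(ℂ, Cn (m + 1)) (⊤ : WithTop ℕ∞) X]
    (H : A.IsProjection h) {x : X} (hx : x ∈ A.Kᶜ) :
    ContMDiffAt 𝓘(ℝ, Cn (m + 1)) 𝓘(ℝ, ℂ) (⊤ : ℕ∞) h x := by
  have : IsManifold 𝓘(ℝ, Cn m) (⊤ : ℕ∞) Y := isManifold_real
  have : IsManifold 𝓘(ℝ, Cn (m + 1)) (⊤ : ℕ∞) X := isManifold_real
  have : IsManifold 𝓘(ℝ, Cn (m + 1)) 1 X :=
    IsManifold.of_le (n := (⊤ : ℕ∞)) (by exact_mod_cast le_top)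
  obtain ⟨p, hp, rfl⟩ := A.exists_Φ_eq hx
  let c := p.2
  let ψ := chartAt (Cn m) c
  let e := chartAt (Cn (m + 1)) (A.Φ p)
  let w₀ : Cn (m + 1) := Fin.cons p.1 (ψ c)
  have htail : Fin.tail w₀ = ψ c := Fin.tail_cons _ _
  have hw : Fin.tail w₀ ∈ ψ.target := by rw [htail]; exact mem_chart_target _ c
  have hpw : (w₀ 0, ψ.symm (Fin.tail w₀)) = p := by
    rw [htail, ψ.left_inv (mem_chart_source _ c)]; rfl
  have hΦw : A.endChart c w₀ = A.Φ p := congrArg A.Φ hpw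
  have hpw' : (w₀ 0, ψ.symm (Fin.tail w₀)) ∈ A.K'ᶜ := by rw [hpw]; exact hp
  have hsm := A.contMDiffAt_endChart c hw hpw'
  have he : ContMDiffAt 𝓘(ℝ, Cn (m + 1)) 𝓘(ℝ, Cn (m + 1)) (⊤ : ℕ∞) e (A.endChart c w₀) := by
    rw [hΦw]
    exact contMDiffOn_chart.contMDiffAt (chart_source_mem_nhds _ _)
  let F := e ∘ A.endChart c
  have hF : ContDiffAt ℝ (⊤ : ℕ∞) F w₀ := contMDiffAt_iff_contDiffAt.1 (he.comp w₀ hsm)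
  have hFd : HasFDerivAt F (fderiv ℝ F w₀) w₀ := (hF.differentiableAt (by simp)).hasFDerivAt
  have hchain : ∀ v, fderiv ℝ F w₀ v = (mfderiv 𝓘(ℝ, Cn (m + 1)) 𝓘(ℝ, Cn (m + 1)) e (A.Φ p))
      (A.endDiff p (v 0, chartFrame c (ψ c) (Fin.tail v))) := by
    intro v
    have h1 := mfderiv_comp w₀ (he.mdifferentiableAt (by simp)) (hsm.mdifferentiableAt (by simp))
    rw [mfderiv_eq_fderiv] at h1
    have h2 := congrArg (fun T : Cn (m + 1) →L[ℝ] Cn (m + 1) => T v) h1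
    refine h2.trans ?_
    have h3 := A.mfderiv_endChart c hw hpw' v
    rw [← hΦw]
    refine congrArg (mfderiv 𝓘(ℝ, Cn (m + 1)) 𝓘(ℝ, Cn (m + 1)) e (A.endChart c w₀)) (h3.trans ?_)
    rw [htail]
    change A.endDiff (w₀ 0, ψ.symm (ψ c)) _ = _
    rw [← htail, hpw]
  have hinj : Function.Injective (fderiv ℝ F w₀) := by
    intro v v' hv
    rw [hchain, hchain] at hv
    have h1 := (A.endDiff_bijective hp).1
      ((mdifferentiable_chart (I := 𝓘(ℝ, Cn (m + 1))) (A.Φ p)).mfderiv_injective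
        (mem_chart_source _ _) hv)
    obtain ⟨L, hL⟩ := exists_chartFrame_eq c (mem_chart_target (Cn m) c)
    have h2 : chartFrame c (ψ c) (Fin.tail v) = chartFrame c (ψ c) (Fin.tail v') :=
      congrArg Prod.snd h1
    rw [hL] at h2
    have h3 : Fin.tail v = Fin.tail v' := L.injective h2
    rw [← Fin.cons_self_tail v, ← Fin.cons_self_tail v', h3,
      show v 0 = v' 0 from congrArg Prod.fst h1]
  let T : Cn (m + 1) ≃L[ℝ] Cn (m + 1) :=
    (LinearEquiv.ofInjectiveEndo (fderiv ℝ F w₀ : Cn (m + 1) →ₗ[ℝ] Cn (m + 1))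
      hinj).toContinuousLinearEquiv
  have hT : HasFDerivAt F (T : Cn (m + 1) →L[ℝ] Cn (m + 1)) w₀ := by
    convert hFd using 1
    ext1 v
    rfl
  have hn : ((⊤ : ℕ∞) : WithTop ℕ∞) ≠ 0 := by simp
  let G := hF.localInverse hT hn
  have hG : ContDiffAt ℝ (⊤ : ℕ∞) G (F w₀) := hF.to_localInverse hT hn
  have hGF : ∀ᶠ u in 𝓝 (F w₀), F (G u) = u :=
    (hF.hasStrictFDerivAt' hT hn).eventually_right_inverse
  have hGw : G (F w₀) = w₀ := hF.localInverse_apply_image hT hn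
  have hFw : F w₀ = e (A.Φ p) := congrArg e hΦw
  have hGc : Tendsto G (𝓝 (F w₀)) (𝓝 w₀) := by
    have := hG.continuousAt.tendsto
    rwa [hGw] at this
  -- near `Φ p` the projection is the first coordinate of the local inverse of `F`, to the power `n`
  have hev : h =ᶠ[𝓝 (A.Φ p)] fun x => (G (e x) 0) ^ orderOf A.σ := by
    have hcont : Tendsto e (𝓝 (A.Φ p)) (𝓝 (F w₀)) := by
      rw [hFw]; exact e.continuousAt (mem_chart_source _ _)
    have hK : ∀ᶠ w in 𝓝 w₀, (w 0, ψ.symm (Fin.tail w)) ∈ A.K'ᶜ ∧ A.endChart c w ∈ e.source := by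
      have hc1 : ContinuousAt (fun w : Cn (m + 1) => (w 0, ψ.symm (Fin.tail w))) w₀ := by
        refine ContinuousAt.prodMk (continuous_apply 0).continuousAt ?_
        exact (ψ.continuousAt_symm hw).comp (f := fun w : Cn (m + 1) => (Fin.tail w : Cn m))
          (continuous_pi fun j => continuous_apply (Fin.succ j)).continuousAt
      refine (hc1.eventually (A.isOpen_compl_K'.mem_nhds hpw')).and
        (hsm.continuousAt.eventually (e.open_source.mem_nhds ?_))
      rw [hΦw]; exact mem_chart_source _ _
    filter_upwards [hcont.eventually hGF, hcont.eventually (hGc.eventually hK),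
      chart_source_mem_nhds (Cn (m + 1)) (A.Φ p)] with x h1 h2 h3
    have h4 : A.endChart c (G (e x)) = x := e.injOn h2.2 h3 h1
    conv_lhs => rw [← h4]
    exact H.comp_Φ _ h2.1
  refine ContMDiffAt.congr_of_eventuallyEq ?_ hev
  have hG0 : ContDiffAt ℝ (⊤ : ℕ∞) (fun u => G u 0 ^ orderOf A.σ) (e (A.Φ p)) := by
    rw [← hFw]
    exact ((contDiffAt_pi.1 hG) 0).pow _
  exact (contMDiffAt_iff_contDiffAt.2 hG0).comp (A.Φ p)
    (contMDiffOn_chart.contMDiffAt (chart_source_mem_nhds _ _))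

end IsProjection

end WeakALG

/-! ### Pull-backs of forms on `ℂ` by the projection -/

theorem areaForm_comp_apply {E : Type*} [AddCommGroup E] [Module ℝ E] [TopologicalSpace E]
    (L : E →L[ℝ] ℂ) (v w : E) :
    areaForm.compContinuousLinearMap L ![v, w] = areaForm ![L v, L w] := by
  rw [ContinuousAlternatingMap.compContinuousLinearMap_apply]
  congr 1; ext k; fin_cases k <;> rfl

theorem twoForm_ext {E : Type*} [AddCommGroup E] [Module ℝ E] [TopologicalSpace E]
    {a b : E [⋀^Fin 2]→L[ℝ] ℝ} (h : ∀ v w, a ![v, w] = b ![v, w]) : a = b := by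
  ext v
  have : v = ![v 0, v 1] := by ext k; fin_cases k <;> rfl
  rw [this]
  exact h _ _

/-- The 2-form `ε^p ∧ ε^q` built from the real coordinates of `ℂ^d`. -/
def coordTwoForm {d : ℕ} (p q : Fin d × Fin 2) : Cn d [⋀^Fin 2]→L[ℝ] ℝ :=
  areaForm.compContinuousLinearMap (LinearMap.toContinuousLinearMap
    (((stdBasis d).coord p).smulRight (1 : ℂ) + ((stdBasis d).coord q).smulRight Complex.I))

theorem areaForm_comp_eq_sum {d : ℕ} (L : Cn d →L[ℝ] ℂ) :
    areaForm.compContinuousLinearMap L = ∑ p, ∑ q,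
      (2⁻¹ * areaForm ![L (stdBasis d p), L (stdBasis d q)]) • coordTwoForm p q := by
  refine twoForm_ext fun v w => ?_
  have hL : ∀ v, L v = ∑ p, (stdBasis d).repr v p • L (stdBasis d p) := by
    intro v
    conv_lhs => rw [← (stdBasis d).sum_repr v, map_sum]
    simp only [map_smul]
  have hre : ∀ v, (L v).re = ∑ p, (stdBasis d).repr v p * (L (stdBasis d p)).re := by
    intro v; rw [hL, Complex.re_sum]; simp
  have him : ∀ v, (L v).im = ∑ p, (stdBasis d).repr v p * (L (stdBasis d p)).im := by
    intro v; rw [hL, Complex.im_sum]; simp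
  have hco : ∀ p q, coordTwoForm p q ![v, w]
      = (stdBasis d).repr v p * (stdBasis d).repr w q
        - (stdBasis d).repr w p * (stdBasis d).repr v q := by
    intro p q
    rw [coordTwoForm, areaForm_comp_apply, areaForm_apply]
    simp
  simp only [areaForm_comp_apply, ContinuousAlternatingMap.sum_apply,
    ContinuousAlternatingMap.smul_apply, hco, smul_eq_mul]
  simp only [areaForm_apply, Matrix.cons_val_zero, Matrix.cons_val_one]
  set V := (stdBasis d).repr v
  set W := (stdBasis d).repr w
  set a := fun p => (L (stdBasis d p)).re
  set b := fun p => (L (stdBasis d p)).im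
  have h1 : ∑ p, ∑ q, 2⁻¹ * (a p * b q - a q * b p) * (V p * W q - W p * V q)
      = ∑ p, ∑ q, V p * a p * (W q * b q) - ∑ p, ∑ q, W p * a p * (V q * b q) := by
    have h2 : ∑ p, ∑ q, 2⁻¹ * (a p * b q - a q * b p) * (V p * W q - W p * V q)
        = ∑ p, ∑ q, (2⁻¹ * (V p * a p * (W q * b q) - W p * a p * (V q * b q)))
          + ∑ p, ∑ q, (2⁻¹ * (V q * a q * (W p * b p) - W q * a q * (V p * b p))) := by
      simp only [← Finset.sum_add_distrib]
      refine Finset.sum_congr rfl fun p _ => Finset.sum_congr rfl fun q _ => ?_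
      ring
    rw [h2, Finset.sum_comm (f := fun p q => 2⁻¹ * (V q * a q * (W p * b p) - W q * a q * (V p * b p))),
      ← Finset.sum_add_distrib, ← Finset.sum_sub_distrib]
    refine Finset.sum_congr rfl fun p _ => ?_
    rw [← Finset.sum_add_distrib, ← Finset.sum_sub_distrib]
    refine Finset.sum_congr rfl fun q _ => ?_
    ring
  refine Eq.trans ?_ h1.symm
  rw [hre v, hre w, him v, him w, Finset.sum_mul_sum, Finset.sum_mul_sum]

theorem contDiff_areaForm_comp {d : ℕ} :
    ContDiff ℝ (⊤ : ℕ∞) fun L : Cn d →L[ℝ] ℂ => areaForm.compContinuousLinearMap L := by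
  simp only [areaForm_comp_eq_sum, areaForm_apply, Matrix.cons_val_zero, Matrix.cons_val_one]
  have hre : ∀ v : Cn d, ContDiff ℝ (⊤ : ℕ∞) fun L : Cn d →L[ℝ] ℂ => (L v).re := fun v =>
    (Complex.reCLM.comp (ContinuousLinearMap.apply ℝ ℂ v)).contDiff
  have him : ∀ v : Cn d, ContDiff ℝ (⊤ : ℕ∞) fun L : Cn d →L[ℝ] ℂ => (L v).im := fun v =>
    (Complex.imCLM.comp (ContinuousLinearMap.apply ℝ ℂ v)).contDiff
  exact ContDiff.sum fun p _ => ContDiff.sum fun q _ => (contDiff_const.mul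
    (((hre _).mul (him _)).sub ((hre _).mul (him _)))).smul contDiff_const

/-- A 3-form on a real vector space of dimension 2 vanishes. -/
theorem threeForm_complex_eq_zero (a : ℂ [⋀^Fin 3]→L[ℝ] ℝ) : a = 0 := by
  ext v
  refine a.toAlternatingMap.map_linearDependent v fun h => ?_
  have := h.fintype_card_le_finrank
  simp [Complex.finrank_real_complex] at this

/-- A form `f^* (g dx ∧ dy)` is smooth and closed. -/
theorem contDiffAt_pullback_area {d : ℕ} {f : Cn d → ℂ} {g : ℂ → ℝ} (hg : ContDiff ℝ (⊤ : ℕ∞) g)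
    {y : Cn d} (hf : ContDiffAt ℝ (⊤ : ℕ∞) f y) :
    ContDiffAt ℝ (⊤ : ℕ∞)
        (fun z => g (f z) • areaForm.compContinuousLinearMap (fderiv ℝ f z)) y ∧
      extDeriv (fun z => g (f z) • areaForm.compContinuousLinearMap (fderiv ℝ f z)) y = 0 := by
  constructor
  · exact (hg.contDiffAt.comp y hf).smul
      (contDiff_areaForm_comp.contDiffAt.comp y (hf.fderiv_right (m := (⊤ : ℕ∞)) (by simp)))
  · have h := extDeriv_pullback (ω := fun w => g w • areaForm) (f := f) (x := y)
      (r := ((⊤ : ℕ∞) : WithTop ℕ∞))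
      (((hg.differentiable (by simp)) (f y)).smul_const areaForm) hf
      (by
        rw [minSmoothness_of_isRCLikeNormedField]
        exact WithTop.coe_le_coe.2 (le_top : (2 : ℕ∞) ≤ ⊤))
    rw [threeForm_complex_eq_zero (extDeriv (fun w => g w • areaForm) (f y))] at h
    exact h

section
variable {d : ℕ} {X : Type*} [TopologicalSpace X] [ChartedSpace (Cn d) X]

open Classical in
/-- The 2-form `h^* (g dx ∧ dy)` outside `K`, extended by zero. -/
def pullbackForm (K : Set X) (h : X → ℂ) (g : ℂ → ℝ) : TwoForm d X := fun x =>
  if x ∈ K then 0 else g (h x) • areaForm.compContinuousLinearMap (realDiff h x)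

theorem pullbackForm_apply {K : Set X} {h : X → ℂ} {g : ℂ → ℝ} {x : X} (hx : x ∈ Kᶜ) (v w : Cn d) :
    pullbackForm K h g x ![v, w] = g (h x) * areaForm ![realDiff h x v, realDiff h x w] := by
  rw [pullbackForm, if_neg hx, ContinuousAlternatingMap.smul_apply, areaForm_comp_apply, smul_eq_mul]

theorem pullbackForm_of_mem {K : Set X} {h : X → ℂ} {g : ℂ → ℝ} {x : X} (hx : x ∈ K) :
    (pullbackForm K h g x : Cn d [⋀^Fin 2]→L[ℝ] ℝ) = 0 := if_pos hx

/-- The form `h^* (g dx ∧ dy)` is smooth and closed if it vanishes outside a closed set on whose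
complement `h` is smooth. -/
theorem contDiffAt_localForm_pullbackForm [IsManifold 𝓘(ℂ, Cn d) (⊤ : WithTop ℕ∞) X]
    {K : Set X} {h : X → ℂ} {g : ℂ → ℝ} (hg : ContDiff ℝ (⊤ : ℕ∞) g) (hK : IsOpen Kᶜ)
    (hh : ∀ x ∈ Kᶜ, ContMDiffAt 𝓘(ℝ, Cn d) 𝓘(ℝ, ℂ) (⊤ : ℕ∞) h x)
    {Z : Set X} (hZ : IsClosed Z) (hZK : Z ⊆ Kᶜ)
    (hZ0 : ∀ x ∉ Z, (pullbackForm K h g x : Cn d [⋀^Fin 2]→L[ℝ] ℝ) = 0)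
    (c : X) {y : Cn d} (hy : y ∈ (chartAt (Cn d) c).target) :
    ContDiffAt ℝ (⊤ : ℕ∞) (localForm (pullbackForm K h g) c) y ∧
      extDeriv (localForm (pullbackForm K h g) c) y = 0 := by
  have : IsManifold 𝓘(ℝ, Cn d) (⊤ : ℕ∞) X := isManifold_real
  have : IsManifold 𝓘(ℝ, Cn d) 1 X := IsManifold.of_le (n := (⊤ : ℕ∞)) (by exact_mod_cast le_top)
  let e := chartAt (Cn d) c
  by_cases hyZ : e.symm y ∈ Z
  · have hyK : e.symm y ∈ Kᶜ := hZK hyZ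
    let f := h ∘ e.symm
    have hf : ContDiffAt ℝ (⊤ : ℕ∞) f y := by
      rw [← contMDiffAt_iff_contDiffAt]
      exact (hh _ hyK).comp y (contMDiffOn_chart_symm.contMDiffAt (e.open_target.mem_nhds hy))
    have hev : localForm (pullbackForm K h g) c =ᶠ[𝓝 y]
        fun z => g (f z) • areaForm.compContinuousLinearMap (fderiv ℝ f z) := by
      filter_upwards [e.open_target.mem_nhds hy,
        (e.continuousAt_symm hy).eventually (hK.mem_nhds hyK)] with z hz hzK
      refine twoForm_ext fun v w => ?_
      have h1 : ∀ v, fderiv ℝ f z v = realDiff h (e.symm z) (chartFrame c z v) := by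
        intro v
        have := mfderiv_comp z ((hh _ hzK).mdifferentiableAt (by simp))
          ((mdifferentiable_chart (I := 𝓘(ℝ, Cn d)) c).symm.mdifferentiableAt hz)
        rw [mfderiv_eq_fderiv] at this
        exact congrArg (fun T : Cn d →L[ℝ] ℂ => T v) this
      rw [ContinuousAlternatingMap.smul_apply, areaForm_comp_apply, h1, h1, smul_eq_mul]
      refine Eq.trans ?_ (pullbackForm_apply hzK _ _)
      rw [localForm, ContinuousAlternatingMap.compContinuousLinearMap_apply]
      congr 1; ext1 k; fin_cases k <;> rfl
    have hp := contDiffAt_pullback_area hg hf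
    exact ⟨hp.1.congr_of_eventuallyEq hev, hev.extDeriv_eq.trans hp.2⟩
  · have hev : localForm (pullbackForm K h g) c =ᶠ[𝓝 y] fun _ => 0 := by
      filter_upwards [(e.continuousAt_symm hy).eventually (hZ.isOpen_compl.mem_nhds hyZ)] with z hz
      rw [localForm, hZ0 _ hz]
      rfl
    refine ⟨contDiffAt_const.congr_of_eventuallyEq hev, hev.extDeriv_eq.trans ?_⟩
    ext v
    simp [extDeriv, ContinuousAlternatingMap.alternatizeUncurryFin_apply]

end

/-! ### The profile of the bump form -/

/-- The function `g` on `ℂ/⟨σ⟩`, in the coordinate `w = z ^ n`, such that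
`χ (t / |z|) (i/2) du ∧ dū`, `u = 1/z`, is `g (w) (i/2) dw ∧ dw̄`. -/
def bumpProfile (n : ℕ) (χ : ℝ → ℝ) (t : ℝ) (w : ℂ) : ℝ :=
  χ (‖w‖ ^ (-(n : ℝ)⁻¹) * t) * (‖w‖ ^ (-(n : ℝ)⁻¹)) ^ (2 * (n + 1)) / n ^ 2

theorem bumpProfile_pow {n : ℕ} (hn : n ≠ 0) (χ : ℝ → ℝ) (t : ℝ) (z : ℂ) :
    bumpProfile n χ t (z ^ n) = χ (‖z⁻¹‖ * t) * ‖z⁻¹‖ ^ (2 * (n + 1)) / n ^ 2 := by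
  have : ‖z ^ n‖ ^ (-(n : ℝ)⁻¹) = ‖z⁻¹‖ := by
    rw [norm_pow, Real.rpow_neg (by positivity), Real.pow_rpow_inv_natCast (norm_nonneg z) hn,
      norm_inv]
  rw [bumpProfile, this]

theorem bumpProfile_nonneg {n : ℕ} {χ : ℝ → ℝ} (hχ : IsStandardCutoff χ) (t : ℝ) (w : ℂ) :
    0 ≤ bumpProfile n χ t w := by
  have := (hχ.mem_Icc (‖w‖ ^ (-(n : ℝ)⁻¹) * t)).1
  unfold bumpProfile
  positivity

theorem contDiff_bumpProfile {n : ℕ} (hn : n ≠ 0) {χ : ℝ → ℝ} (hχ : IsStandardCutoff χ) {t : ℝ}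
    (ht : 0 < t) : ContDiff ℝ (⊤ : ℕ∞) (bumpProfile n χ t) := by
  rw [contDiff_iff_contDiffAt]
  intro w
  rcases eq_or_ne w 0 with rfl | hw
  · -- the profile vanishes near the origin, where `|w|^{-1/n} t` is large
    have hev : bumpProfile n χ t =ᶠ[𝓝 0] fun _ => 0 := by
      filter_upwards [Metric.ball_mem_nhds (0 : ℂ) (show 0 < (t / 4) ^ n by positivity)] with w hw
      rw [mem_ball_zero_iff] at hw
      obtain ⟨z, rfl⟩ := IsAlgClosed.exists_pow_nat_eq w (Nat.pos_of_ne_zero hn)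
      rw [norm_pow] at hw
      have hz : ‖z‖ < t / 4 := lt_of_pow_lt_pow_left₀ n (by positivity) hw
      rw [bumpProfile_pow hn, hχ.eq_zero]
      · simp
      · rcases eq_or_ne z 0 with rfl | hz0
        · left; simp
        · right
          have := norm_pos_iff.2 hz0
          rw [norm_inv, ← div_eq_inv_mul, le_div_iff₀ this]
          linarith
    exact contDiffAt_const.congr_of_eventuallyEq hev
  · have h1 : ContDiffAt ℝ (⊤ : ℕ∞) (fun w : ℂ => ‖w‖ ^ (-(n : ℝ)⁻¹)) w :=
      ((contDiffAt_norm ℝ hw)).rpow_const_of_ne (norm_ne_zero_iff.2 hw)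
    exact ((hχ.smooth.contDiffAt.comp w (h1.mul contDiffAt_const)).mul (h1.pow _)).div_const _

theorem bumpProfile_eq_zero {n : ℕ} (hn : n ≠ 0) {χ : ℝ → ℝ} (hχ : IsStandardCutoff χ) {t : ℝ}
    {z : ℂ} (hz : ‖z‖ ≤ t / 4 ∨ t ≤ ‖z‖) : bumpProfile n χ t (z ^ n) = 0 := by
  rw [bumpProfile_pow hn, hχ.eq_zero]
  · simp
  · rcases eq_or_ne z 0 with rfl | hz0
    · left; simp
    · have := norm_pos_iff.2 hz0
      rw [norm_inv, ← div_eq_inv_mul, le_div_iff₀ this, div_le_iff₀ this]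
      rcases hz with hz | hz
      · right; linarith
      · left; linarith

/-- The profile times the square of the Jacobian of `z ↦ z ^ n` is the coefficient of the bump form
with respect to `(i/2) dz ∧ dz̄`. -/
theorem bumpProfile_mul_norm_sq {n : ℕ} (hn : n ≠ 0) (χ : ℝ → ℝ) (t : ℝ) {z : ℂ} (hz : z ≠ 0) :
    bumpProfile n χ t (z ^ n) * ‖(n : ℂ) * z ^ (n - 1)‖ ^ 2
      = χ (‖z⁻¹‖ * t) * (‖z‖ ^ 4)⁻¹ := by
  rw [bumpProfile_pow hn, norm_mul, norm_pow, norm_inv, Complex.norm_natCast, inv_pow]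
  have hz' := norm_ne_zero_iff.2 hz
  have hn' : (n : ℝ) ≠ 0 := by exact_mod_cast hn
  obtain ⟨k, rfl⟩ := Nat.exists_eq_succ_of_ne_zero hn
  simp only [Nat.succ_eq_add_one, Nat.add_sub_cancel] at *
  field_simp
  ring

/-! ### The bump form and the perturbed Kähler form -/

namespace WeakALG

variable {m : ℕ} {X Y : Type*} [TopologicalSpace X] [ChartedSpace (Cn (m + 1)) X]
  [TopologicalSpace Y] [ChartedSpace (Cn m) Y] {β : ℝ} {ω : TwoForm (m + 1) X}
  (A : WeakALG (Y := Y) β ω) {h : X → ℂ} {R t : ℝ} {χ : ℝ → ℝ}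

theorem orderOf_ne_zero : orderOf A.σ ≠ 0 := A.σ_finiteOrder.ne'

/-- The form that equals `χ (ρ t) (i/2) du ∧ dū` on the end and vanishes elsewhere, written as the
pull-back of a form on `ℂ/⟨σ⟩` by the projection `h`. -/
def unitBump (A : WeakALG (Y := Y) β ω) (h : X → ℂ) (χ : ℝ → ℝ) (t : ℝ) : TwoForm (m + 1) X :=
  pullbackForm A.K h (bumpProfile (orderOf A.σ) χ t)

/-- The part `{t/4 ≤ |z| ≤ t}` of the end, which contains the support of the bump form. -/
def bumpRegion (A : WeakALG (Y := Y) β ω) (t : ℝ) : Set X :=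
  A.Φ '' {p | t / 4 ≤ ‖p.1‖ ∧ ‖p.1‖ ≤ t}

theorem notMem_K' (hRK : ∀ p ∈ A.K', ‖p.1‖ ≤ R) {p : ℂ × Y} (hp : R < ‖p.1‖) : p ∈ A.K'ᶜ :=
  fun h => (hRK p h).not_gt hp

theorem isCompact_bumpRegion [CompactSpace Y] (hR : 0 < R) (hRK : ∀ p ∈ A.K', ‖p.1‖ ≤ R)
    (ht : 10 * R < t) : IsCompact (A.bumpRegion t) := by
  have h1 : {p : ℂ × Y | t / 4 ≤ ‖p.1‖ ∧ ‖p.1‖ ≤ t}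
      = (Metric.closedBall (0 : ℂ) t ∩ {z | t / 4 ≤ ‖z‖}) ×ˢ univ := by
    ext p
    simp [and_comm]
  refine IsCompact.image_of_continuousOn ?_ (A.Φ_smooth.continuousOn.mono fun p hp =>
    A.notMem_K' hRK (by linarith [hp.1]))
  rw [h1]
  exact ((isCompact_closedBall _ _).inter_right
    (isClosed_le continuous_const continuous_norm)).prod isCompact_univ

theorem bumpRegion_subset (hR : 0 < R) (hRK : ∀ p ∈ A.K', ‖p.1‖ ≤ R) (ht : 10 * R < t) :
    A.bumpRegion t ⊆ A.Kᶜ := by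
  rintro _ ⟨p, hp, rfl⟩
  exact A.Φ_mem (A.notMem_K' hRK (by linarith [hp.1]))

variable {A}

theorem unitBump_eq_zero (H : A.IsProjection h) (hχ : IsStandardCutoff χ) {x : X}
    (hx : x ∉ A.bumpRegion t) : A.unitBump h χ t x = 0 := by
  by_cases hK : x ∈ A.K
  · exact pullbackForm_of_mem hK
  obtain ⟨p, hp, rfl⟩ := A.exists_Φ_eq hK
  rw [unitBump, pullbackForm, if_neg hK, H.comp_Φ p hp, bumpProfile_eq_zero A.orderOf_ne_zero hχ,
    zero_smul]
  by_contra hcon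
  push Not at hcon
  exact hx ⟨p, ⟨hcon.1.le, hcon.2.le⟩, rfl⟩

theorem unitBump_apply_Φ (H : A.IsProjection h) {p : ℂ × Y} (hp : p ∈ A.K'ᶜ) (v w : Cn (m + 1)) :
    A.unitBump h χ t (A.Φ p) ![v, w] = bumpProfile (orderOf A.σ) χ t (p.1 ^ orderOf A.σ)
      * areaForm ![realDiff h (A.Φ p) v, realDiff h (A.Φ p) w] := by
  rw [unitBump, pullbackForm_apply (A.Φ_mem hp), H.comp_Φ p hp]

theorem twoForm_comp_eq_smul_area {E F : Type*} [AddCommGroup E] [Module ℝ E] [TopologicalSpace E]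
    [AddCommGroup F] [Module ℝ F] [TopologicalSpace F] (a : F [⋀^Fin 2]→L[ℝ] ℝ) (T : E →L[ℝ] F)
    (U : E →L[ℝ] ℂ) {u : E → ℂ} (hU : ∀ q, U q = u q) (c : ℝ)
    (h : ∀ q q', a ![T q, T q'] = c * areaForm ![u q, u q']) :
    a.compContinuousLinearMap T = c • areaForm.compContinuousLinearMap U := by
  refine twoForm_ext fun q q' => ?_
  rw [ContinuousAlternatingMap.smul_apply, areaForm_comp_apply, hU, hU, smul_eq_mul, ← h,
    ContinuousAlternatingMap.compContinuousLinearMap_apply]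
  congr 1; ext1 k; fin_cases k <;> rfl

/-- In the coordinate `z` of the cover, `h` is `z ^ n`, so that `h^* (g dx ∧ dy)` has the coefficient
`g (z ^ n) n² |z|^{2n-2}` with respect to the area form in `z`, and `|z|⁴` times that with respect to
`(i/2) du ∧ dū`. -/
theorem isBumpForm_smul_unitBump [T2Space X] [T2Space Y] (H : A.IsProjection h)
    (hχ : IsStandardCutoff χ) (hR : 0 < R)
    (hRK : ∀ p ∈ A.K', ‖p.1‖ ≤ R) (ht : 10 * R < t) (s : ℝ) :
    A.IsBumpForm R χ t s (s • A.unitBump h χ t) := by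
  refine ⟨fun p hp => ?_, fun x hx => ?_⟩
  · have hpK := A.notMem_K' hRK hp
    have hz : p.1 ≠ 0 := norm_pos_iff.1 (hR.trans hp)
    have hinv : HasFDerivAt (fun z : ℂ => z⁻¹) ((ContinuousLinearMap.toSpanSingleton ℂ
        (-(p.1 ^ 2)⁻¹)).restrictScalars ℝ) p.1 :=
      (hasDerivAt_inv hz).hasFDerivAt.restrictScalars ℝ
    have h2 : HasMFDerivAt (𝓘(ℝ, ℂ).prod 𝓘(ℝ, Cn m)) 𝓘(ℝ, ℂ)
        ((fun z : ℂ => z⁻¹) ∘ (Prod.fst : ℂ × Y → ℂ)) p _ :=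
      hinv.hasMFDerivAt.comp p (hasMFDerivAt_fst (x := p))
    have h3 : ∀ q : ℂ × Cn m, (mfderiv (𝓘(ℝ, ℂ).prod 𝓘(ℝ, Cn m)) 𝓘(ℝ, ℂ)
        (fun q : ℂ × Y => q.1⁻¹) p : ℂ × Cn m →L[ℝ] ℂ) q = -(p.1 ^ 2)⁻¹ * q.1 := by
      intro q
      refine (congrArg (fun T : ℂ × Cn m →L[ℝ] ℂ => T q) h2.mfderiv).trans ?_
      change ContinuousLinearMap.toSpanSingleton ℂ (-(p.1 ^ 2)⁻¹) q.1 = _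
      rw [ContinuousLinearMap.toSpanSingleton_apply, smul_eq_mul, mul_comm]
    have hscale : ∀ (c a b : ℂ), areaForm ![c * a, c * b] = ‖c‖ ^ 2 * areaForm ![a, b] := by
      intro c a b
      rw [← areaForm_mul_left]
      congr 1; ext k; fin_cases k <;> rfl
    refine twoForm_comp_eq_smul_area ((s • A.unitBump h χ t) (A.Φ p)) (A.endDiff p) _ h3 _
      fun a b => ?_
    rw [hscale, Pi.smul_apply, ContinuousAlternatingMap.smul_apply, unitBump_apply_Φ H hpK,
      H.realDiff_endDiff hpK, H.realDiff_endDiff hpK, hscale, smul_eq_mul,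
      ← mul_assoc (bumpProfile _ _ _ _), bumpProfile_mul_norm_sq A.orderOf_ne_zero _ _ hz,
      norm_neg, norm_inv (p.1 ^ 2), norm_pow]
    ring
  · have : x ∉ A.bumpRegion t := by
      rintro ⟨p, hp, rfl⟩
      exact hx ⟨p, show R < ‖p.1‖ by linarith [hp.1], rfl⟩
    rw [Pi.smul_apply, unitBump_eq_zero H hχ this, smul_zero]

/-- The density, with respect to `ω^d`, of the change of `ω^d` under the perturbation. -/
def bumpDensity (A : WeakALG (Y := Y) β ω) (h : X → ℂ) (χ : ℝ → ℝ) (t : ℝ) (x : X) : ℝ :=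
  formRatio (topPow (ω + A.unitBump h χ t)) (topPow ω) x - 1

theorem bumpDensity_eq_zero (H : A.IsProjection h) (hχ : IsStandardCutoff χ) {x : X}
    (hx : x ∉ A.bumpRegion t) : A.bumpDensity h χ t x = 0 := by
  have : topPow (ω + A.unitBump h χ t) x = topPow ω x := by
    rw [topPow, Pi.add_apply, unitBump_eq_zero H hχ hx, add_zero]; rfl
  rw [bumpDensity, formRatio, this, div_self (A.kahler.topPow_pos x).ne', sub_self]

/-- As the bump form has rank 2, the top power of `ω + s • η` is affine in `s`. -/
theorem formRatio_add_smul_unitBump [T2Space X] (H : A.IsProjection h) (hχ : IsStandardCutoff χ)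
    (x : X) :
    0 ≤ A.bumpDensity h χ t x ∧ ∀ s : ℝ,
      formRatio (topPow (ω + s • A.unitBump h χ t)) (topPow ω) x
        = 1 + s * A.bumpDensity h χ t x := by
  have hω := A.kahler.topPow_pos x
  by_cases hK : x ∈ A.K
  · have h0 : A.unitBump h χ t x = 0 := pullbackForm_of_mem hK
    have h1 : ∀ s : ℝ, formRatio (topPow (ω + s • A.unitBump h χ t)) (topPow ω) x = 1 := by
      intro s
      have : topPow (ω + s • A.unitBump h χ t) x = topPow ω x := by
        rw [topPow, Pi.add_apply, Pi.smul_apply, h0, smul_zero, add_zero]; rfl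
      rw [formRatio, this, div_self hω.ne']
    have h2 : A.bumpDensity h χ t x = 0 := by
      have := h1 1
      rw [one_smul] at this
      rw [bumpDensity, this, sub_self]
    rw [h2]
    exact ⟨le_rfl, fun s => by rw [h1, mul_zero, add_zero]⟩
  · obtain ⟨ℓ, hℓ⟩ := H.exists_realDiff_eq hK
    obtain ⟨L, r, -, hL, hr⟩ := (A.kahler.isPositiveForm x).exists_unitary ℓ
    have h1 : ∀ s : ℝ, formRatio (topPow (ω + s • A.unitBump h χ t)) (topPow ω) x
        = 1 + s * (bumpProfile (orderOf A.σ) χ t (h x) * r ^ 2) := by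
      intro s
      have hη : ∀ v w, (s • A.unitBump h χ t x) ![v, w]
          = s * bumpProfile (orderOf A.σ) χ t (h x) * areaForm ![ℓ v, ℓ w] := by
        intro v w
        rw [ContinuousAlternatingMap.smul_apply, unitBump, pullbackForm_apply hK, hℓ, hℓ,
          smul_eq_mul, mul_assoc]
      have h2 := twoFormWedgePow_add_pullback hη hL hr
      have h3 : topPow (ω + s • A.unitBump h χ t) x (stdFrame (m + 1)) = _ := h2
      rw [formRatio, h3]
      exact (mul_div_cancel_right₀ _ hω.ne').trans (by rw [mul_assoc])
    have h2 : A.bumpDensity h χ t x = bumpProfile (orderOf A.σ) χ t (h x) * r ^ 2 := by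
      have := h1 1
      rw [one_smul] at this
      rw [bumpDensity, this]; ring
    rw [h2]
    exact ⟨mul_nonneg (bumpProfile_nonneg hχ _ _) (sq_nonneg r), h1⟩

section Kahler

variable [T2Space X] [IsManifold 𝓘(ℂ, Cn (m + 1)) (⊤ : WithTop ℕ∞) X]
  [T2Space Y] [CompactSpace Y] [IsManifold 𝓘(ℂ, Cn m) (⊤ : WithTop ℕ∞) Y]

theorem contDiffAt_localForm_unitBump (H : A.IsProjection h)
    (hχ : IsStandardCutoff χ) (hR : 0 < R) (hRK : ∀ p ∈ A.K', ‖p.1‖ ≤ R) (ht : 10 * R < t)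
    (c : X) {y : Cn (m + 1)} (hy : y ∈ (chartAt (Cn (m + 1)) c).target) :
    ContDiffAt ℝ (⊤ : ℕ∞) (localForm (A.unitBump h χ t) c) y ∧
      extDeriv (localForm (A.unitBump h χ t) c) y = 0 :=
  contDiffAt_localForm_pullbackForm
    (contDiff_bumpProfile A.orderOf_ne_zero hχ (by linarith)) A.isOpen_compl_K
    (fun _ hx => H.contMDiffAt hx) (A.isCompact_bumpRegion hR hRK ht).isClosed
    (A.bumpRegion_subset hR hRK ht) (fun _ hx => unitBump_eq_zero H hχ hx) c hy

theorem contDiffOn_localForm_add_unitBump (H : A.IsProjection h)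
    (hχ : IsStandardCutoff χ) (hR : 0 < R) (hRK : ∀ p ∈ A.K', ‖p.1‖ ≤ R) (ht : 10 * R < t) (s : ℝ)
    (c : X) : ContDiffOn ℝ (⊤ : ℕ∞) (localForm (ω + s • A.unitBump h χ t) c)
      (chartAt (Cn (m + 1)) c).target := fun y hy =>
  (A.kahler.smooth c y hy).add ((contDiffAt_localForm_unitBump H hχ hR hRK ht c
    hy).1.const_smul s).contDiffWithinAt

/-- The perturbed form is a Kähler form as long as the coefficient of the bump form is small compared
with the metric on its support. -/
theorem isKahlerForm_add_unitBump (H : A.IsProjection h)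
    (hχ : IsStandardCutoff χ) (hβ : 0 < β) (hR : 0 < R) (hRK : ∀ p ∈ A.K', ‖p.1‖ ≤ R)
    (ht : 10 * R < t) {Q : ℝ} (hQ : A.IsQuasiConstant R Q) {s : ℝ}
    (hs : |s| * Q < (t / 4) ^ (2 * β + 2)) :
    IsKahlerForm (ω + s • A.unitBump h χ t) where
  smooth := contDiffOn_localForm_add_unitBump H hχ hR hRK ht s
  closed c y hy := by
    have h1 := contDiffAt_localForm_unitBump H hχ hR hRK ht c hy
    have h2 : ContDiffAt ℝ (⊤ : ℕ∞) (localForm ω c) y :=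
      (A.kahler.smooth c).contDiffAt ((chartAt (Cn (m + 1)) c).open_target.mem_nhds hy)
    have h3 : localForm (ω + s • A.unitBump h χ t) c
        = localForm ω c + s • localForm (A.unitBump h χ t) c := rfl
    rw [h3, extDeriv_add (h2.differentiableAt (by simp))
      ((h1.1.differentiableAt (by simp)).const_smul s), extDeriv_smul, h1.2, A.kahler.closed c y hy,
      smul_zero, add_zero]
  invariant x v w := by
    simp only [Pi.add_apply, Pi.smul_apply, ContinuousAlternatingMap.add_apply,
      ContinuousAlternatingMap.smul_apply, A.kahler.invariant]
    congr 2
    by_cases hK : x ∈ A.K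
    · rw [unitBump, pullbackForm_of_mem hK]; rfl
    · obtain ⟨ℓ, hℓ⟩ := H.exists_realDiff_eq hK
      rw [unitBump, pullbackForm_apply hK, pullbackForm_apply hK]
      simp only [hℓ, map_smul, smul_eq_mul, areaForm_I]
  positive x v hv := by
    rw [Pi.add_apply, Pi.smul_apply, ContinuousAlternatingMap.add_apply,
      ContinuousAlternatingMap.smul_apply, smul_eq_mul]
    have hω := A.kahler.positive x v hv
    by_cases hx : x ∈ A.bumpRegion t
    swap
    · rw [unitBump_eq_zero H hχ hx]
      simpa using hω
    obtain ⟨p, hp, rfl⟩ := hx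
    have hpR : R < ‖p.1‖ := by linarith [hp.1]
    have hpK := A.notMem_K' hRK hpR
    obtain ⟨ℓ, hℓ⟩ := H.exists_realDiff_eq (A.Φ_mem hpK)
    obtain ⟨⟨a, b⟩, rfl⟩ := (A.endDiff_bijective hpK).2 v
    have hzpos : 0 < ‖p.1‖ := hR.trans hpR
    have hQpos : 0 < Q := lt_of_lt_of_le (by norm_num) hQ.1
    have hbump : A.unitBump h χ t (A.Φ p) ![A.endDiff p (a, b), Complex.I • A.endDiff p (a, b)]
        = χ (‖p.1⁻¹‖ * t) * (‖p.1‖ ^ 4)⁻¹ * ‖a‖ ^ 2 := by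
      rw [unitBump_apply_Φ H hpK, hℓ (Complex.I • _), map_smul, ← hℓ, smul_eq_mul, areaForm_self_I,
        H.realDiff_endDiff hpK, norm_mul, mul_pow, ← mul_assoc,
        bumpProfile_mul_norm_sq A.orderOf_ne_zero _ _ (norm_pos_iff.1 hzpos)]
    rw [hbump]
    rcases eq_or_ne a 0 with rfl | ha
    · simpa using hω
    have hquasi : (‖p.1‖ ^ (2 * β - 2) * ‖a‖ ^ 2 + kahlerSq A.ωY p.2 b) / Q
        ≤ ω (A.Φ p) ![A.endDiff p (a, b), Complex.I • A.endDiff p (a, b)] :=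
      (hQ.2 p hpR a b).1
    have hY : 0 ≤ kahlerSq A.ωY p.2 b := by
      rcases eq_or_ne b 0 with rfl | hb
      · have := twoForm_smul_left (A.ωY p.2) 0 0 (Complex.I • 0)
        simp only [zero_smul, zero_mul] at this
        exact this.ge
      · exact (A.kahlerY.positive p.2 b hb).le
    have hrpow : ‖p.1‖ ^ (2 * β - 2) = ‖p.1‖ ^ (2 * β + 2) * (‖p.1‖ ^ 4)⁻¹ := by
      rw [show 2 * β - 2 = (2 * β + 2) + (-4 : ℝ) by ring, Real.rpow_add hzpos, Real.rpow_neg hzpos.le]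
      norm_cast
    have hmono : (t / 4) ^ (2 * β + 2) ≤ ‖p.1‖ ^ (2 * β + 2) :=
      Real.rpow_le_rpow (by linarith) hp.1 (by linarith)
    have hχ01 := hχ.mem_Icc (‖p.1⁻¹‖ * t)
    set E := (‖p.1‖ ^ 4)⁻¹ * ‖a‖ ^ 2 with hE
    have hEpos : 0 < E := by
      have := norm_pos_iff.2 ha
      positivity
    have h1 : |s| * E < ω (A.Φ p) ![A.endDiff p (a, b), Complex.I • A.endDiff p (a, b)] := by
      refine lt_of_lt_of_le ?_ hquasi
      rw [lt_div_iff₀ hQpos, hrpow]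
      have : |s| * Q * E < ‖p.1‖ ^ (2 * β + 2) * E :=
        mul_lt_mul_of_pos_right (hs.trans_le hmono) hEpos
      rw [hE] at this ⊢
      nlinarith
    have h2 : -(|s| * E) ≤ s * (χ (‖p.1⁻¹‖ * t) * E) := by
      have h3 : |s * (χ (‖p.1⁻¹‖ * t) * E)| ≤ |s| * E := by
        rw [abs_mul, abs_mul, abs_of_nonneg hχ01.1, abs_of_pos hEpos]
        exact mul_le_mul_of_nonneg_left (mul_le_of_le_one_left hEpos.le hχ01.2) (abs_nonneg _)
      exact (abs_le.1 h3).1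
    rw [mul_assoc (χ _)]
    linarith

theorem continuous_bumpDensity (H : A.IsProjection h) (hχ : IsStandardCutoff χ) (hR : 0 < R)
    (hRK : ∀ p ∈ A.K', ‖p.1‖ ≤ R) (ht : 10 * R < t) : Continuous (A.bumpDensity h χ t) := by
  have h1 := contDiffOn_localForm_add_unitBump H hχ hR hRK ht 1
  rw [one_smul] at h1
  exact (continuous_formRatio A.kahler h1).sub continuous_const

theorem integrable_bumpDensity [SecondCountableTopology X] [Nonempty X] [MeasurableSpace X]
    [BorelSpace X] (H : A.IsProjection h) (hχ : IsStandardCutoff χ) (hR : 0 < R)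
    (hRK : ∀ p ∈ A.K', ‖p.1‖ ≤ R) (ht : 10 * R < t) :
    Integrable (A.bumpDensity h χ t) (formMeasure (topPow ω)) := by
  have := isLocallyFiniteMeasure_formMeasure A.kahler
  exact (continuous_bumpDensity H hχ hR hRK ht).integrable_of_hasCompactSupport
    (HasCompactSupport.intro (A.isCompact_bumpRegion hR hRK ht)
      fun x hx => bumpDensity_eq_zero H hχ hx)

end Kahler

end WeakALG

/-! ### A fundamental domain of the end and the volume of the bump -/

/-- The part of the annulus `{t/3 < |z| < t/2}` in a sector of angle `2π/n`. -/
def annularSector (n : ℕ) (t : ℝ) : Set ℂ :=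
  {z | ‖z‖ ∈ Ioo (t / 3) (t / 2) ∧ z.arg ∈ Ioo (-Real.pi) (-Real.pi + 2 * Real.pi / n)}

theorem measurableSet_annularSector (n : ℕ) (t : ℝ) : MeasurableSet (annularSector n t) :=
  (measurable_norm measurableSet_Ioo).inter (Complex.measurable_arg measurableSet_Ioo)

/-- The sector contains at most one representative of each orbit of the `n`-th roots of unity. -/
theorem eq_one_of_mem_annularSector {n : ℕ} (hn : n ≠ 0) {t : ℝ} {z u : ℂ} (ht : 0 < t)
    (hz : z ∈ annularSector n t) (hu : u ^ n = 1) (hzu : u * z ∈ annularSector n t) : u = 1 := by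
  have hn' : (0 : ℝ) < n := by exact_mod_cast Nat.pos_of_ne_zero hn
  have hu1 : ‖u‖ = 1 := Complex.norm_eq_one_of_pow_eq_one hu hn
  have hz0 : z ≠ 0 := norm_pos_iff.1 (lt_trans (by positivity) hz.1.1)
  have hzn : (‖z‖ : ℂ) ≠ 0 := by exact_mod_cast norm_ne_zero_iff.2 hz0
  set δ := (u * z).arg - z.arg with hδ
  have hexp : u = Complex.exp (δ * Complex.I) := by
    have h1 := Complex.norm_mul_exp_arg_mul_I (u * z)
    have h2 := Complex.norm_mul_exp_arg_mul_I z
    rw [norm_mul, hu1, one_mul] at h1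
    have h3 : Complex.exp ((u * z).arg * Complex.I)
        = Complex.exp (δ * Complex.I) * Complex.exp (z.arg * Complex.I) := by
      rw [← Complex.exp_add]
      congr 1
      rw [hδ]; push_cast; ring
    refine mul_right_cancel₀ hz0 ?_
    rw [← h1, h3]
    conv_rhs => rw [← h2]
    ring
  have hδn : |δ| < 2 * Real.pi / n := by
    rw [abs_lt]
    constructor <;> linarith [hz.2.1, hz.2.2, hzu.2.1, hzu.2.2]
  rw [hexp, ← Complex.exp_nat_mul, Complex.exp_eq_one_iff] at hu
  obtain ⟨j, hj⟩ := hu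
  have hj' : (n : ℝ) * δ = j * (2 * Real.pi) := by
    have h4 : ((n * δ : ℝ) : ℂ) * Complex.I = ((j * (2 * Real.pi) : ℝ) : ℂ) * Complex.I := by
      push_cast
      linear_combination hj
    exact_mod_cast mul_right_cancel₀ Complex.I_ne_zero h4
  have hj0 : j = 0 := by
    have h5 : |(j : ℝ)| * (2 * Real.pi) < 1 * (2 * Real.pi) := by
      have h6 : |(j : ℝ) * (2 * Real.pi)| = n * |δ| := by rw [← hj', abs_mul, Nat.abs_cast]
      rw [abs_mul, abs_of_pos Real.two_pi_pos] at h6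
      rw [h6, one_mul]
      rwa [lt_div_iff₀ hn', mul_comm] at hδn
    have h7 := lt_of_mul_lt_mul_right h5 Real.two_pi_pos.le
    have h8 : |j| < 1 := by exact_mod_cast h7
    exact Int.abs_lt_one_iff.1 h8
  have hδ0 : δ = 0 := by
    rw [hj0, Int.cast_zero, zero_mul] at hj'
    exact (mul_eq_zero.1 hj').resolve_left hn'.ne'
  rw [hexp, hδ0]; simp

theorem volume_annularSector_ge {n : ℕ} (hn : n ≠ 0) {t : ℝ} (ht : 0 < t) :
    ENNReal.ofReal (2 * Real.pi * t ^ 2 / (18 * n)) ≤ volume (annularSector n t) := by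
  have hn' : (1 : ℝ) ≤ n := by exact_mod_cast Nat.one_le_iff_ne_zero.2 hn
  have hpi := Real.pi_pos
  have hS := measurableSet_annularSector n t
  have hle : -Real.pi + 2 * Real.pi / n ≤ Real.pi := by
    have : 2 * Real.pi / n ≤ 2 * Real.pi := div_le_self (by positivity) hn'
    linarith
  let D : Set (ℝ × ℝ) := Ioo (t / 3) (t / 2) ×ˢ Ioo (-Real.pi) (-Real.pi + 2 * Real.pi / n)
  have hD : MeasurableSet D := measurableSet_Ioo.prod measurableSet_Ioo
  have hDt : D ⊆ polarCoord.target := by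
    rintro ⟨r, θ⟩ ⟨h1, h2⟩
    exact ⟨lt_trans (show (0 : ℝ) < t / 3 by positivity) h1.1, h2.1, h2.2.trans_le hle⟩
  rw [← lintegral_indicator_one hS, ← Complex.lintegral_comp_polarCoord_symm]
  calc ENNReal.ofReal (2 * Real.pi * t ^ 2 / (18 * n))
      = ∫⁻ p in D, ENNReal.ofReal (t / 3) := by
        rw [setLIntegral_const, Measure.volume_eq_prod, Measure.prod_prod, Real.volume_Ioo,
          Real.volume_Ioo, ← ENNReal.ofReal_mul (by linarith), ← ENNReal.ofReal_mul (by positivity)]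
        congr 1
        field_simp
        ring
    _ ≤ ∫⁻ p in D, ENNReal.ofReal p.1 • (annularSector n t).indicator 1
          (Complex.polarCoord.symm p) := by
        refine setLIntegral_mono' hD fun p hp => ?_
        have hpol : Complex.polarCoord.symm p = p.1 * Complex.exp (p.2 * Complex.I) := by
          rw [Complex.polarCoord_symm_apply, Complex.exp_mul_I, Complex.ofReal_cos,
            Complex.ofReal_sin]
        have h0 : 0 < p.1 := lt_trans (by positivity) hp.1.1
        have hmem : Complex.polarCoord.symm p ∈ annularSector n t := by
          constructor
          · rw [hpol, norm_mul, Complex.norm_exp_ofReal_mul_I, mul_one, Complex.norm_real,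
              Real.norm_eq_abs, abs_of_pos h0]
            exact hp.1
          · have harg : (Complex.polarCoord.symm p).arg = p.2 := by
              rw [hpol, Complex.exp_mul_I]
              exact Complex.arg_mul_cos_add_sin_mul_I h0 ⟨hp.2.1, hp.2.2.le.trans hle⟩
            rw [harg]; exact hp.2
        rw [indicator_of_mem hmem, Pi.one_apply, smul_eq_mul, mul_one]
        exact ENNReal.ofReal_le_ofReal hp.1.1.le
    _ ≤ _ := lintegral_mono_set hDt

/-- Integration over the product of a subset of `ℂ` and a subset of `ℂ^m`. -/
theorem setLIntegral_tail {m : ℕ} {S : Set ℂ} (hS : MeasurableSet S) {P : Set (Cn m)}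
    (hP : MeasurableSet P) {g : Cn m → ENNReal} (hg : AEMeasurable g (volume.restrict P)) :
    MeasurableSet {w : Cn (m + 1) | w 0 ∈ S ∧ Fin.tail w ∈ P} ∧
      ∫⁻ w in {w : Cn (m + 1) | w 0 ∈ S ∧ Fin.tail w ∈ P}, g (Fin.tail w)
        = volume S * ∫⁻ y in P, g y := by
  have hmp := volume_preserving_piFinSuccAbove (fun _ : Fin (m + 1) => ℂ) 0
  have hset : {w : Cn (m + 1) | w 0 ∈ S ∧ Fin.tail w ∈ P}
      = MeasurableEquiv.piFinSuccAbove (fun _ : Fin (m + 1) => ℂ) 0 ⁻¹' (S ×ˢ P) := by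
    ext w
    simp [MeasurableEquiv.piFinSuccAbove, Fin.insertNthEquiv]
  have htail : ∀ w : Cn (m + 1), Fin.tail w
      = (MeasurableEquiv.piFinSuccAbove (fun _ : Fin (m + 1) => ℂ) 0 w).2 := by
    intro w
    simp [MeasurableEquiv.piFinSuccAbove, Fin.insertNthEquiv]
  refine ⟨hset ▸ hmp.measurable (hS.prod hP), ?_⟩
  rw [hset]
  simp only [htail]
  rw [hmp.setLIntegral_comp_preimage_emb (MeasurableEquiv.measurableEmbedding _)
    (fun q : ℂ × Cn m => g q.2), Measure.volume_eq_prod, ← Measure.prod_restrict]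
  have := lintegral_prod_mul (μ := (volume : Measure ℂ).restrict S)
    (ν := (volume : Measure (Cn m)).restrict P) (f := fun _ => 1) (g := g) aemeasurable_const hg
  simpa using this

namespace WeakALG

variable {m : ℕ} {X Y : Type*} [TopologicalSpace X] [ChartedSpace (Cn (m + 1)) X]
  [TopologicalSpace Y] [ChartedSpace (Cn m) Y] {β : ℝ} {ω : TwoForm (m + 1) X}
  {A : WeakALG (Y := Y) β ω} {h : X → ℂ} {R t : ℝ} {χ : ℝ → ℝ}

/-- `Φ` is injective over the sector. -/
theorem Φ_injOn_sector (hR : 0 < R) (hRK : ∀ p ∈ A.K', ‖p.1‖ ≤ R) (ht : 10 * R < t)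
    {p q : ℂ × Y} (hp : p.1 ∈ annularSector (orderOf A.σ) t)
    (hq : q.1 ∈ annularSector (orderOf A.σ) t) (hpq : A.Φ p = A.Φ q) : p = q := by
  have hpK := A.notMem_K' hRK (p := p) (by linarith [hp.1.1])
  have hqK := A.notMem_K' hRK (p := q) (by linarith [hq.1.1])
  obtain ⟨k, rfl⟩ := (A.Φ_eq_iff p hpK q hqK).1 hpq
  have h1 : A.ζ ^ k = 1 := by
    refine eq_one_of_mem_annularSector A.orderOf_ne_zero (by linarith) hp ?_ hq
    rw [← pow_mul, mul_comm, pow_mul, A.ζ_primitive.pow_eq_one, one_pow]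
  have h2 : A.σ ^ k = 1 := orderOf_dvd_iff_pow_eq_one.1 (A.ζ_primitive.dvd_of_pow_eq_one k h1)
  rw [h1, h2, one_mul]; rfl

/-- The pointwise lower bound for the bump density in the coordinates of the end. -/
theorem bumpDensity_mul_frameDet_ge [T2Space X] [T2Space Y]
    [IsManifold 𝓘(ℂ, Cn (m + 1)) (⊤ : WithTop ℕ∞) X] [IsManifold 𝓘(ℂ, Cn m) (⊤ : WithTop ℕ∞) Y]
    (H : A.IsProjection h) (hχ : IsStandardCutoff χ)
    (hR : 0 < R) (hRK : ∀ p ∈ A.K', ‖p.1‖ ≤ R) (ht : 10 * R < t) {Q : ℝ}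
    (hQ : A.IsQuasiConstant R Q) (c : Y) {w : Cn (m + 1)}
    (hw : Fin.tail w ∈ (chartAt (Cn m) c).target) (hw0 : ‖w 0‖ ∈ Ioo (t / 3) (t / 2)) :
    16 / t ^ 4 * ((m + 1) / Q ^ m) * localDensity (topPow A.ωY) c (Fin.tail w)
      ≤ topPow ω (A.endChart c w) (stdFrame (m + 1)) * |frameDet (A.endChart c) w|
        * A.bumpDensity h χ t (A.endChart c w) := by
  have htpos : 0 < t := by linarith
  have hQpos : 0 < Q := lt_of_lt_of_le (by norm_num) hQ.1
  set y := (chartAt (Cn m) c).symm (Fin.tail w) with hy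
  set p : ℂ × Y := (w 0, y) with hpdef
  have hz : 0 < ‖w 0‖ := lt_trans (by positivity) hw0.1
  have hpR : R < ‖p.1‖ := by
    have := hw0.1
    change R < ‖w 0‖
    linarith
  have hpK : p ∈ A.K'ᶜ := A.notMem_K' hRK hpR
  have hx : A.endChart c w = A.Φ p := rfl
  have hxK : A.Φ p ∉ A.K := A.Φ_mem hpK
  obtain ⟨ℓ, hℓ⟩ := H.exists_realDiff_eq (A.Φ_mem hpK)
  let T : Cn (m + 1) →L[ℝ] Cn (m + 1) :=
    mfderiv 𝓘(ℝ, Cn (m + 1)) 𝓘(ℝ, Cn (m + 1)) (A.endChart c) w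
  have hT : ∀ v, T v = A.endDiff p (v 0, chartFrame c (Fin.tail w) (Fin.tail v)) :=
    A.mfderiv_endChart c hw hpK
  have hdet : frameDet (A.endChart c) w = LinearMap.det (T : Cn (m + 1) →ₗ[ℝ] Cn (m + 1)) := rfl
  have hlow := wedgePow_fibre_comparison (A.kahler.isPositiveForm (A.Φ p)) (ℓ := ℓ)
    (η := A.unitBump h χ t (A.Φ p)) (bumpProfile_nonneg hχ t (w 0 ^ orderOf A.σ))
    (fun v v' => by rw [unitBump_apply_Φ H hpK, hℓ, hℓ])
    (T : Cn (m + 1) →ₗ[ℝ] Cn (m + 1))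
    (c := (orderOf A.σ : ℂ) * w 0 ^ (orderOf A.σ - 1))
    (fun v => by
      rw [← hℓ]
      exact (congrArg (realDiff h (A.Φ p)) (hT v)).trans (H.realDiff_endDiff hpK _))
    (A.kahlerY.isPositiveForm_localForm c hw) hQpos (fun v => by
      have h1 := (hQ.2 p hpR 0 (chartFrame c (Fin.tail w) v)).1
      have h2 : T (Fin.cons 0 v) = A.endDiff p (0, chartFrame c (Fin.tail w) v) := by
        rw [hT]; simp
      have h3 : localForm A.ωY c (Fin.tail w) ![v, Complex.I • v]
          = kahlerSq A.ωY y (chartFrame c (Fin.tail w) v) := by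
        rw [localForm, ContinuousAlternatingMap.compContinuousLinearMap_apply, kahlerSq,
          ← chartFrame_I_smul c hw]
        congr 1; ext1 k; fin_cases k <;> rfl
      rw [norm_zero, zero_pow two_ne_zero, mul_zero, zero_add] at h1
      rw [h3]
      refine h1.trans (le_of_eq ?_)
      change kahlerSq ω (A.Φ p) (A.endDiff p (0, chartFrame c (Fin.tail w) v)) = _
      rw [← h2]; rfl)
  rw [bumpProfile_mul_norm_sq A.orderOf_ne_zero _ _ (norm_pos_iff.1 hz), hχ.eq_one, one_mul] at hlow
  swap
  · rw [norm_inv, ← div_eq_inv_mul]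
    refine ⟨?_, ?_⟩
    · rw [le_div_iff₀ hz]; linarith [hw0.2]
    · rw [div_le_iff₀ hz]; linarith [hw0.1]
  have hD := localDensity_topPow_pos A.kahlerY c hw
  rw [localDensity_topPow] at hD ⊢
  have h16 : 16 / t ^ 4 ≤ (‖w 0‖ ^ 4)⁻¹ := by
    have h1 : ‖w 0‖ ^ 4 ≤ (t / 2) ^ 4 := pow_le_pow_left₀ hz.le hw0.2.le 4
    calc 16 / t ^ 4 = ((t / 2) ^ 4)⁻¹ := by field_simp; norm_num
      _ ≤ _ := inv_anti₀ (by positivity) h1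
  have hdens : topPow ω (A.Φ p) (stdFrame (m + 1)) * A.bumpDensity h χ t (A.Φ p)
      = twoFormWedgePow (ω (A.Φ p) + A.unitBump h χ t (A.Φ p)) (stdFrame (m + 1))
        - twoFormWedgePow (ω (A.Φ p)) (stdFrame (m + 1)) := by
    have hne := (A.kahler.topPow_pos (A.Φ p)).ne'
    rw [bumpDensity, formRatio, mul_sub, mul_div_cancel₀ _ hne, mul_one]
    rfl
  calc 16 / t ^ 4 * ((m + 1) / Q ^ m) * twoFormWedgePow (localForm A.ωY c (Fin.tail w)) (stdFrame m)
      ≤ (‖w 0‖ ^ 4)⁻¹ * ((m + 1) / Q ^ m)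
          * twoFormWedgePow (localForm A.ωY c (Fin.tail w)) (stdFrame m) := by
        gcongr
    _ ≤ _ := hlow
    _ = topPow ω (A.Φ p) (stdFrame (m + 1)) * |frameDet (A.endChart c) w|
        * A.bumpDensity h χ t (A.Φ p) := by
        rw [← hdens, hdet]; ring

section

variable [T2Space X] [SecondCountableTopology X] [Nonempty X]
  [IsManifold 𝓘(ℂ, Cn (m + 1)) (⊤ : WithTop ℕ∞) X] [MeasurableSpace X] [BorelSpace X]
  [T2Space Y] [SecondCountableTopology Y] [Nonempty Y] [CompactSpace Y]
  [IsManifold 𝓘(ℂ, Cn m) (⊤ : WithTop ℕ∞) Y] [MeasurableSpace Y] [BorelSpace Y]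

/-- The lower bound for the total mass of the bump: the sector is a fundamental domain for `σ`, and
the bump density is bounded below by a multiple of the product of the area of the sector and of the
volume of `Y`. -/
theorem integral_bumpDensity_ge (H : A.IsProjection h) (hχ : IsStandardCutoff χ)
    (hR : 0 < R) (hRK : ∀ p ∈ A.K', ‖p.1‖ ≤ R) (ht : 10 * R < t) {Q : ℝ}
    (hQ : A.IsQuasiConstant R Q) :
    2 * Real.pi * t ^ 2 / (18 * orderOf A.σ) * (16 / t ^ 4 * ((m + 1) / Q ^ m))
        * formIntegral (topPow A.ωY)
      ≤ ∫ x, A.bumpDensity h χ t x ∂formMeasure (topPow ω) := by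
  have htpos : 0 < t := by linarith
  have hQpos : 0 < Q := lt_of_lt_of_le (by norm_num) hQ.1
  set n := orderOf A.σ with hn
  have hn0 : n ≠ 0 := A.orderOf_ne_zero
  set κ : ℝ := 16 / t ^ 4 * ((m + 1) / Q ^ m) with hκ
  have hκ0 : 0 ≤ κ := by positivity
  have hX := continuousOn_localDensity_topPow A.kahler.smooth
  have hY := continuousOn_localDensity_topPow A.kahlerY.smooth
  set S := annularSector n t with hS
  let s : ℕ → Set (Cn (m + 1)) := fun j => {w | w 0 ∈ S ∧ Fin.tail w ∈ chartPiece m Y j}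
  let c := chartSeq m Y
  let f : ℕ → Cn (m + 1) → X := fun j => A.endChart (c j)
  have hφm : Measurable fun x => ENNReal.ofReal (A.bumpDensity h χ t x) :=
    (continuous_bumpDensity H hχ hR hRK ht).measurable.ennreal_ofReal
  have hnorm : ∀ j, ∀ w ∈ s j, R < ‖w 0‖ := fun j w hw => by linarith [hw.1.1.1]
  have hmd : ∀ j, ∀ w ∈ s j, MDifferentiableAt 𝓘(ℝ, Cn (m + 1)) 𝓘(ℝ, Cn (m + 1)) (f j) w :=
    fun j w hw => (A.contMDiffAt_endChart (c j) hw.2.1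
      (A.notMem_K' hRK (hnorm j w hw))).mdifferentiableAt (by simp)
  have hinj' : ∀ i j, ∀ v ∈ s i, ∀ w ∈ s j, f i v = f j w →
      v 0 = w 0 ∧ (chartAt (Cn m) (c i)).symm (Fin.tail v)
        = (chartAt (Cn m) (c j)).symm (Fin.tail w) := fun i j v hv w hw hvw =>
    Prod.ext_iff.1 (Φ_injOn_sector hR hRK ht (p := (v 0, (chartAt (Cn m) (c i)).symm (Fin.tail v)))
      (q := (w 0, (chartAt (Cn m) (c j)).symm (Fin.tail w))) hv.1 hw.1 hvw)
  have hinj : ∀ j, InjOn (f j) (s j) := fun j v hv w hw hvw => by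
    obtain ⟨h0, h1⟩ := hinj' j j v hv w hw hvw
    have h2 := (chartAt (Cn m) (c j)).symm.injOn hv.2.1 hw.2.1 h1
    rw [← Fin.cons_self_tail v, ← Fin.cons_self_tail w, h0, h2]
  have hdisj : Pairwise (Function.onFun Disjoint fun j => f j '' s j) := by
    intro i j hij
    rw [Function.onFun, Set.disjoint_left]
    rintro _ ⟨v, hv, rfl⟩ ⟨w, hw, hvw⟩
    have h1 := (hinj' j i w hw v hv hvw).2
    have h2 : (chartAt (Cn m) (c i)).symm (Fin.tail v) ∈ manifoldPiece m Y i := hv.2.2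
    have h3 : (chartAt (Cn m) (c j)).symm (Fin.tail w) ∈ manifoldPiece m Y j := hw.2.2
    rw [h1] at h3
    exact Set.disjoint_left.1 (disjoint_manifoldPiece hij) h2 h3
  have hκm : ∀ j, AEMeasurable (fun y => ENNReal.ofReal (κ * localDensity (topPow A.ωY) (c j) y))
      (volume.restrict (chartPiece m Y j)) := fun j =>
    (((hY (c j)).mono inter_subset_left).aemeasurable
      (measurableSet_chartPiece j)).const_mul κ |>.ennreal_ofReal
  have hset := fun j => setLIntegral_tail (measurableSet_annularSector n t)
    (measurableSet_chartPiece (d := m) (X := Y) j) (hκm j)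
  have hcv := fun j => setLIntegral_image_formMeasure hX hφm (hset j).1 (hinj j) (hmd j)
  have hpiece : ∀ j, volume S * ∫⁻ y in chartPiece m Y j,
        ENNReal.ofReal (κ * localDensity (topPow A.ωY) (c j) y)
      ≤ ∫⁻ x in f j '' s j, ENNReal.ofReal (A.bumpDensity h χ t x) ∂formMeasure (topPow ω) := by
    intro j
    rw [(hcv j).2, ← (hset j).2]
    refine setLIntegral_mono' (hset j).1 fun w hw => ?_
    rw [← ENNReal.ofReal_mul (mul_nonneg (A.kahler.topPow_pos _).le (abs_nonneg _))]
    exact ENNReal.ofReal_le_ofReal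
      (bumpDensity_mul_frameDet_ge H hχ hR hRK ht hQ (c j) hw.2.1 hw.1.1)
  have hV := formIntegral_topPow_compact A.kahlerY
  have htotal : ENNReal.ofReal (2 * Real.pi * t ^ 2 / (18 * n) * κ * formIntegral (topPow A.ωY))
      ≤ ∫⁻ x, ENNReal.ofReal (A.bumpDensity h χ t x) ∂formMeasure (topPow ω) := by
    calc ENNReal.ofReal (2 * Real.pi * t ^ 2 / (18 * n) * κ * formIntegral (topPow A.ωY))
        = ENNReal.ofReal (2 * Real.pi * t ^ 2 / (18 * n))
            * (ENNReal.ofReal κ * formMeasure (topPow A.ωY) univ) := by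
          rw [hV.2, ← ENNReal.ofReal_mul hκ0, ← ENNReal.ofReal_mul (by positivity), mul_assoc]
      _ ≤ volume S * (ENNReal.ofReal κ * formMeasure (topPow A.ωY) univ) := by
          gcongr
          exact volume_annularSector_ge hn0 htpos
      _ = ∑' j, volume S * ∫⁻ y in chartPiece m Y j,
            ENNReal.ofReal (κ * localDensity (topPow A.ωY) (c j) y) := by
          rw [formMeasure_univ, ← ENNReal.tsum_mul_left, ← ENNReal.tsum_mul_left]
          congr 1; funext j
          rw [← lintegral_const_mul' _ _ ENNReal.ofReal_ne_top]
          simp only [ENNReal.ofReal_mul hκ0]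
          rfl
      _ ≤ ∑' j, ∫⁻ x in f j '' s j,
            ENNReal.ofReal (A.bumpDensity h χ t x) ∂formMeasure (topPow ω) :=
          ENNReal.tsum_le_tsum hpiece
      _ = ∫⁻ x in ⋃ j, f j '' s j,
            ENNReal.ofReal (A.bumpDensity h χ t x) ∂formMeasure (topPow ω) :=
          (lintegral_iUnion (fun j => (hcv j).1) hdisj _).symm
      _ ≤ _ := setLIntegral_le_lintegral _ _
  have hφ0 : ∀ x, 0 ≤ A.bumpDensity h χ t x := fun x => (formRatio_add_smul_unitBump H hχ x).1
  rw [← ofReal_integral_eq_lintegral_ofReal (integrable_bumpDensity H hχ hR hRK ht)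
    (Eventually.of_forall hφ0), ENNReal.ofReal_le_ofReal_iff (integral_nonneg hφ0)] at htotal
  exact htotal

end

end WeakALG

/-! ### The choice of the parameter `s` -/

theorem IsStandardCutoff.integral_mem_Ioc {χ : ℝ → ℝ} (hχ : IsStandardCutoff χ) :
    ∫ y in Ioi (0 : ℝ), χ y * y ∈ Ioc (0 : ℝ) 16 := by
  have hcont : Continuous fun y => χ y * y := hχ.smooth.continuous.mul continuous_id
  have h4 : ∫ y in Ioi (0 : ℝ), χ y * y = ∫ y in Ioc (0 : ℝ) 4, χ y * y :=
    setIntegral_eq_of_subset_of_forall_sdiff_eq_zero measurableSet_Ioi Ioc_subset_Ioi_self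
      fun y hy => by
        have : 4 < y := lt_of_not_ge fun h => hy.2 ⟨hy.1, h⟩
        rw [hχ.eq_zero y (Or.inr this.le), zero_mul]
  have hint : IntegrableOn (fun y => χ y * y) (Ioc 0 4) := hcont.integrableOn_Ioc
  rw [h4]
  constructor
  · have h1 : ∫ y in Ioc (2 : ℝ) 3, (1 : ℝ) ≤ ∫ y in Ioc (2 : ℝ) 3, χ y * y :=
      setIntegral_mono_on (by simp) hcont.integrableOn_Ioc measurableSet_Ioc fun y hy => by
        rw [hχ.eq_one y ⟨hy.1.le, hy.2⟩]
        linarith [hy.1]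
    have h2 : ∫ y in Ioc (2 : ℝ) 3, χ y * y ≤ ∫ y in Ioc (0 : ℝ) 4, χ y * y :=
      setIntegral_mono_set hint
        ((ae_restrict_iff' measurableSet_Ioc).2 (Eventually.of_forall fun y hy =>
          mul_nonneg (hχ.mem_Icc y).1 hy.1.le))
        (Ioc_subset_Ioc (by norm_num) (by norm_num)).eventuallyLE
    have h3 : ∫ y in Ioc (2 : ℝ) 3, (1 : ℝ) = 1 := by simp; norm_num
    linarith
  · calc ∫ y in Ioc (0 : ℝ) 4, χ y * y ≤ ∫ y in Ioc (0 : ℝ) 4, (4 : ℝ) :=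
        setIntegral_mono_on hint (by simp) measurableSet_Ioc fun y hy => by
          nlinarith [(hχ.mem_Icc y).1, (hχ.mem_Icc y).2, hy.1, hy.2]
      _ = 16 := by simp; norm_num

/-- The bound on the parameter `s = -D / I` for which the perturbed form stays positive: it follows
from the lower bound for `I` and from `t` being larger than the threshold. -/
theorem abs_div_mul_lt_of_threshold_lt {β t Q V c D I n : ℝ} (hβ : 0 < β) (ht : 0 < t) (hQ : 0 < Q)
    (hV : 0 < V) (hc : c ∈ Ioc (0 : ℝ) 16) (hn : 0 < n) (m : ℕ)
    (hI : 2 * Real.pi * t ^ 2 / (18 * n) * (16 / t ^ 4 * ((m + 1) / Q ^ m)) * V ≤ I)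
    (hB : (1000 * (32 : ℝ) ^ (2 + 2 * β) * Q ^ (m + 1) * n * |D|
      / (2 * Real.pi * ((m + 1).factorial : ℝ) * (V / (m.factorial : ℝ)) * c)) ^ (1 / (2 * β)) < t) :
    |-D / I| * Q < (t / 4) ^ (2 * β + 2) := by
  have hpi := Real.pi_pos
  have hm : (0 : ℝ) < m.factorial := by exact_mod_cast m.factorial_pos
  have hc0 := hc.1
  set W : ℝ := (32 : ℝ) ^ (2 + 2 * β) with hW
  have hW0 : 0 < W := by positivity
  set L := 2 * Real.pi * t ^ 2 / (18 * n) * (16 / t ^ 4 * ((m + 1) / Q ^ m)) * V with hL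
  have hL0 : 0 < L := by positivity
  set B := 1000 * W * Q ^ (m + 1) * n * |D|
      / (2 * Real.pi * ((m + 1).factorial : ℝ) * (V / (m.factorial : ℝ)) * c) with hBdef
  have hB0 : 0 ≤ B := by positivity
  have hBt : B < t ^ (2 * β) := by
    have := Real.rpow_lt_rpow (by positivity) hB (show 0 < 2 * β by positivity)
    rwa [← Real.rpow_mul hB0, one_div_mul_cancel (by positivity), Real.rpow_one] at this
  have hDL : |D| / L * Q = 18 * t ^ 2 * B * (c / 16) / (1000 * W) := by
    rw [hL, hBdef, Nat.factorial_succ]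
    push_cast
    field_simp
    rw [pow_succ, mul_assoc]
  have hW4 : (4 : ℝ) ^ (2 * β + 2) ≤ W := by
    rw [hW, add_comm]
    exact Real.rpow_le_rpow (by norm_num) (by norm_num) (by positivity)
  have htt : t ^ (2 * β + 2) = t ^ 2 * t ^ (2 * β) := by
    rw [Real.rpow_add ht, mul_comm]; norm_num
  calc |-D / I| * Q = |D| / I * Q := by
        rw [abs_div, abs_neg, abs_of_pos (hL0.trans_le hI)]
    _ ≤ |D| / L * Q := by gcongr
    _ = 18 * t ^ 2 * B * (c / 16) / (1000 * W) := hDL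
    _ ≤ 18 * t ^ 2 * B * 1 / (1000 * W) := by
        gcongr
        linarith [hc.2]
    _ ≤ 18 * t ^ 2 * t ^ (2 * β) * 1 / (1000 * W) := by gcongr
    _ = 18 / 1000 * (t ^ (2 * β + 2) / W) := by rw [htt]; field_simp
    _ < t ^ (2 * β + 2) / W := by
        have : 0 < t ^ (2 * β + 2) / W := by positivity
        linarith
    _ ≤ t ^ (2 * β + 2) / 4 ^ (2 * β + 2) := by gcongr
    _ = (t / 4) ^ (2 * β + 2) := (Real.div_rpow ht.le (by norm_num) _).symm

namespace WeakALG

variable {m : ℕ} {X Y : Type*} [TopologicalSpace X] [ChartedSpace (Cn (m + 1)) X]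
  [TopologicalSpace Y] [ChartedSpace (Cn m) Y] {β : ℝ} {ω : TwoForm (m + 1) X}

/-- A constant for the normalized model, from which the radial scaling factor has been absorbed. -/
theorem exists_isQuasiConstant (A : WeakALG (Y := Y) β ω) {R : ℝ}
    (hRK : ∀ p ∈ A.K', ‖p.1‖ ≤ R) : ∃ Q, A.IsQuasiConstant R Q := by
  obtain ⟨C, hC, H⟩ := A.quasiIsometric
  have hl : 0 < A.lam ^ 2 := pow_pos A.lam_pos 2
  -- `M` bounds the distortion between the models with radial factors `lam ^ 2` and `1`
  set M := max (A.lam ^ 2) (A.lam ^ 2)⁻¹ with hM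
  have hM1 : 1 ≤ M := by
    rcases le_total 1 (A.lam ^ 2) with h | h
    · exact h.trans (le_max_left _ _)
    · exact ((one_le_inv₀ hl).2 h).trans (le_max_right _ _)
  have hM0 : 0 < M := by linarith
  have hlM : A.lam ^ 2 ≤ M := le_max_left _ _
  have hlM' : 1 ≤ M * A.lam ^ 2 := by
    rw [← inv_mul_cancel₀ hl.ne']
    exact mul_le_mul_of_nonneg_right (le_max_right _ _) hl.le
  refine ⟨max 10 (C * M), le_max_left _ _, fun p hp a v => ?_⟩
  obtain ⟨h1, h2⟩ := H p (A.notMem_K' hRK hp) a v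
  have hk : 0 ≤ kahlerSq A.ωY p.2 v := by
    by_cases hv : v = 0
    · subst hv
      exact ((A.ωY p.2).map_coord_zero 0 rfl).ge
    · exact (A.kahlerY.positive p.2 v hv).le
  set k := kahlerSq A.ωY p.2 v
  have hb : 0 ≤ ‖p.1‖ ^ (2 * β - 2) * ‖a‖ ^ 2 := by positivity
  set b := ‖p.1‖ ^ (2 * β - 2) * ‖a‖ ^ 2
  rw [mul_assoc] at h1 h2
  have hQ : C * M ≤ max 10 (C * M) := le_max_right _ _
  constructor
  · refine le_trans ?_ h1
    calc (b + k) / max 10 (C * M) ≤ (b + k) / (C * M) := by gcongr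
      _ ≤ (M * (A.lam ^ 2 * b + k)) / (C * M) := by
          gcongr
          nlinarith
      _ = (A.lam ^ 2 * b + k) / C := by field_simp
  · refine h2.trans ?_
    calc C * (A.lam ^ 2 * b + k) ≤ C * (M * (b + k)) := by
          gcongr
          nlinarith
      _ = C * M * (b + k) := by ring
      _ ≤ max 10 (C * M) * (b + k) := by gcongr

end WeakALG

end

theorem lemma5p1 {m : ℕ} {X Y : Type*}
    [TopologicalSpace X] [T2Space X] [SecondCountableTopology X] [ConnectedSpace X]
    [ChartedSpace (Cn (m + 1)) X] [IsManifold 𝓘(ℂ, Cn (m + 1)) (⊤ : WithTop ℕ∞) X]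
    [MeasurableSpace X] [BorelSpace X]
    [TopologicalSpace Y] [T2Space Y] [SecondCountableTopology Y] [ConnectedSpace Y] [CompactSpace Y]
    [ChartedSpace (Cn m) Y] [IsManifold 𝓘(ℂ, Cn m) (⊤ : WithTop ℕ∞) Y]
    [MeasurableSpace Y] [BorelSpace Y]
    (β : ℝ) (hβ : 0 < β) (ω : TwoForm (m + 1) X) (A : WeakALG (Y := Y) β ω)
    (R : ℝ) (hR : 0 < R) (hRK : ∀ p ∈ A.K', ‖p.1‖ ≤ R)
    (Υ : TopForm (m + 1) X) (hΥ : SmoothTopForm Υ)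
    (hΥ_pos : ∀ x, 0 < formRatio Υ (topPow ω) x)
    (hΥ_int : Integrable (fun x => formRatio Υ (topPow ω) x - 1) (formMeasure (topPow ω)))
    (χ : ℝ → ℝ) (hχ : IsStandardCutoff χ) :
    (∃ Q, A.IsQuasiConstant R Q) ∧
    ∀ Q, A.IsQuasiConstant R Q →
      0 < A.threshold Υ χ R Q ∧
      ∀ t, A.threshold Υ χ R Q < t →
        ∃ (s : ℝ) (η : TwoForm (m + 1) X), A.IsBumpForm R χ t s η ∧
          IsKahlerForm (ω + η) ∧
          FormIntegrable (topPow (ω + η) - Υ) ∧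
          formIntegral (topPow (ω + η) - Υ) = 0 := by
  refine ⟨A.exists_isQuasiConstant hRK, fun Q hQ =>
    ⟨lt_of_lt_of_le (by positivity) (le_max_left _ _), fun t ht => ?_⟩⟩
  have ht10 : 10 * R < t := (le_max_left _ _).trans_lt ht
  have ht0 : 0 < t := by linarith
  have hQ0 : 0 < Q := lt_of_lt_of_le (by norm_num) hQ.1
  obtain ⟨h, H⟩ := A.exists_isProjection
  set μ := formMeasure (topPow ω) with hμ
  set I := ∫ x, A.bumpDensity h χ t x ∂μ with hI
  set D := formIntegral (topPow ω - Υ) with hD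
  have hV := (formIntegral_topPow_compact A.kahlerY).1
  have hn : (0 : ℝ) < orderOf A.σ := by exact_mod_cast A.σ_finiteOrder
  have hIge := WeakALG.integral_bumpDensity_ge H hχ hR hRK ht10 hQ
  have hI0 : 0 < I := lt_of_lt_of_le (by positivity) hIge
  have hsub : ∀ τ : TopForm (m + 1) X, ∀ x,
      formRatio (τ - Υ) (topPow ω) x = formRatio τ (topPow ω) x - formRatio Υ (topPow ω) x := by
    intro τ x
    simp [formRatio, sub_div]
  have hself : ∀ x, formRatio (topPow ω) (topPow ω) x = 1 := fun x =>
    div_self (A.kahler.topPow_pos x).ne'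
  have hΥ_int' : Integrable (formRatio (topPow ω - Υ) (topPow ω)) μ := by
    refine hΥ_int.neg.congr (Eventually.of_forall fun x => ?_)
    simp only [Pi.neg_apply, hsub, hself, neg_sub]
  have hDint : D = ∫ x, formRatio (topPow ω - Υ) (topPow ω) x ∂μ :=
    (formIntegral_eq_integral A.kahler _ hΥ_int').2
  have hbump := WeakALG.integrable_bumpDensity H hχ hR hRK ht10
  -- the total mass of `(ω + s • η)^d - Υ` is `D + s * I`
  have hratio : formRatio (topPow (ω + (-D / I) • A.unitBump h χ t) - Υ) (topPow ω)
      = fun x => formRatio (topPow ω - Υ) (topPow ω) x + -D / I * A.bumpDensity h χ t x := by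
    funext x
    rw [hsub, hsub, hself, (WeakALG.formRatio_add_smul_unitBump H hχ x).2]
    ring
  obtain ⟨h1, h2⟩ := formIntegral_eq_integral A.kahler
    (topPow (ω + (-D / I) • A.unitBump h χ t) - Υ)
    (by rw [hratio]; exact hΥ_int'.add (hbump.const_mul _))
  refine ⟨-D / I, (-D / I) • A.unitBump h χ t,
    WeakALG.isBumpForm_smul_unitBump H hχ hR hRK ht10 _,
    WeakALG.isKahlerForm_add_unitBump H hχ hβ hR hRK ht10 hQ ?_, h1, ?_⟩
  · exact abs_div_mul_lt_of_threshold_lt hβ ht0 hQ0 hV hχ.integral_mem_Ioc hn m hIge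
      ((le_max_right _ _).trans_lt ht)
  · rw [h2, hratio, integral_add hΥ_int' (hbump.const_mul _), integral_const_mul, ← hDint, ← hI,
      div_mul_cancel₀ _ hI0.ne', add_neg_cancel]
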